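/- Let $K$ and $\Bbbk$ be $\mathbb R$ or $\mathbb C$ with $K\subseteq\Bbbk$, let $0\le m\le n$, and let $C\ell_n$ be the Clifford algebra over $K$ with unit $e_0=1$ and generators $e_1,\dots,e_n$, $e_j^2=-1$, $e_je_k=-e_ke_j$ for $j\neq k$. Write $x=(x_0,x_1,\dots,x_m)\in\mathbb R^{m+1}$. Let $\mathcal H$ be the space of all entire hyperholomorphic functions, that is, of all $C^1$ functions $f:\mathbb R^{m+1}\to C\ell_n$ with $Df=\sum_{j=0}^m e_j\,\partial f/\partial x_j=0$ everywhere, with the topology of uniform convergence on compact sets. In any algebra put $$a_1\times\cdots\times a_k=\frac1{k!}\sum_{\sigma\in S_k}a_{\sigma(1)}\cdots a_{\sigma(k)}$$ (the empty product being $1$), and write $a_1^{\alpha_1}\times\cdots\times a_m^{\alpha_m}$ for the symmetric product in which $a_j$ is taken $\alpha_j$ times. Let $\vec x_j=e_jx_0-e_0x_j$ and $V_\alpha(x)=\vec x_1^{\,\alpha_1}\times\cdots\times\vec x_m^{\,\alpha_m}$ for $\alpha\in\mathbb N^m$. Theorem. Let $T=(T_1,\dots,T_m)$ be an $m$-tuple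 of bounded self-adjoint operators on a Hilbert space $H$ over $\Bbbk$. Let $H_0$ be a finite-dimensional Hilbert space over $\Bbbk$ with a unital $K$-linear representation $\rho:C\ell_n\to\mathcal B(H_0)$, and put $\widetilde H=H\otimes H_0$, $V_\alpha(T)=T_1^{\alpha_1}\times\cdots\times T_m^{\alpha_m}\in\mathcal B(H)$. Then $T$ has a hyperholomorphic functional calculus on the whole space: there is a continuous $K$-linear map $\Phi:\mathcal H\to\mathcal B(\widetilde H)$ (operator norm on $\mathcal B(\widetilde H)$) such that 1. $\vec x_j\in\mathcal H$ and $\Phi(\vec x_j)=T_j\otimes I$ for $1\le j\le m$; 2. for all $k\ge 0$ and $1\le j_1,\dots,j_k\le m$, $\vec x_{j_1}\times\cdots\times\vec x_{j_k}\in\mathcal H$ and $\Phi(\vec x_{j_1}\times\cdots\times\vec x_{j_k})=(T_{j_1}\otimes I)\times\cdots\times(T_{j_k}\otimes I)$; 3. for all $f\in\mathcal H$ and $c\in C\ell_n$, $fc\in\mathcal H$ and $\Phi(fc)=\Phi(f)\,(I\otimes\rho(c))$. Moreover, for every $f\in\mathcal H$ there are coefficients $c_\alpha\in C\ell_n$ $(\alpha\in\mathbb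 N^m)$ with $$f(x)=\sum_{\alpha}V_\alpha(x)\,c_\alpha ,\qquad \Phi(f)=\sum_\alpha V_\alpha(T)\otimes\rho(c_\alpha),$$ where the first series converges unconditionally and uniformly on compact sets and the second one converges unconditionally in the operator norm; the $c_\alpha$ are the only coefficients for which the first series converges unconditionally to $f(x)$ at every $x\in\mathbb R^{m+1}$. -/

import Mathlib

open scoped TensorProduct Nat

/-- The Clifford algebra over `K` (`K = ℝ` or `K = ℂ`) generated by `e₁, …, eₙ` subject to
`eⱼ² = -1` and `eⱼ eₖ + eₖ eⱼ = 0` for `j ≠ k`; the unit `1` is the basis vector `e₀`. -/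
abbrev Cl (K : Type*) [RCLike K] (n : ℕ) : Type _ :=
  CliffordAlgebra (QuadraticMap.weightedSumSquares K (fun _ : Fin n => (-1 : K)))

namespace Cl

section Generators

variable (K : Type*) [RCLike K] {n : ℕ}

/-- The generator `eⱼ`. -/
noncomputable def e (j : Fin n) : Cl K n :=
  CliffordAlgebra.ι (QuadraticMap.weightedSumSquares K (fun _ : Fin n => (-1 : K)))
    (Pi.single j 1)

theorem e_mul_self (j : Fin n) : e K j * e K j = -1 := by
  have h : QuadraticMap.weightedSumSquares K (fun _ : Fin n => (-1 : K)) (Pi.single j 1) = -1 := by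
    rw [QuadraticMap.weightedSumSquares_apply, Finset.sum_eq_single j]
    · simp
    · intro b _ hb
      simp [hb]
    · simp
  rw [e, CliffordAlgebra.ι_sq_scalar, h, map_neg, map_one]

theorem e_mul_e_add_swap {j k : Fin n} (h : j ≠ k) : e K j * e K k + e K k * e K j = 0 := by
  rw [e, e, CliffordAlgebra.ι_mul_ι_add_swap]
  have : QuadraticMap.polar (QuadraticMap.weightedSumSquares K (fun _ : Fin n => (-1 : K)))
      (Pi.single j 1) (Pi.single k 1) = 0 := by
    simp only [QuadraticMap.polar, QuadraticMap.weightedSumSquares_apply,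
      ← Finset.sum_sub_distrib]
    refine Finset.sum_eq_zero fun i _ => ?_
    by_cases hi : i = j
    · subst hi
      simp [h]
    · simp [hi]
  rw [this, map_zero]

end Generators

section Norm

variable (K : Type*) [RCLike K] (n : ℕ)

/-- The basis `e_A = e_{j₁} ⋯ e_{jₖ}`, `A = {j₁ < ⋯ < jₖ} ⊆ {1, …, n}`, of the Clifford algebra. -/
noncomputable def basis : Module.Basis (Finset (Fin n)) K (Cl K n) :=
  letI : Invertible (2 : K) := invertibleOfNonzero two_ne_zero
  (Pi.basisFun K (Fin n)).ExteriorAlgebra.map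
    (CliffordAlgebra.equivExterior
      (QuadraticMap.weightedSumSquares K (fun _ : Fin n => (-1 : K)))).symm

/-- The coordinates with respect to the basis `e_A`. -/
noncomputable def coords : Cl K n ≃ₗ[K] EuclideanSpace K (Finset (Fin n)) :=
  (basis K n).equivFun.trans (WithLp.linearEquiv 2 K (Finset (Fin n) → K)).symm

/-- The Euclidean norm `|a| = (∑_A |a_A|²)^{1/2}` of `a = ∑_A a_A e_A`. -/
noncomputable instance : NormedAddCommGroup (Cl K n) :=
  NormedAddCommGroup.induced (Cl K n) (EuclideanSpace K (Finset (Fin n))) (coords K n)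
    (coords K n).injective

noncomputable instance : NormedSpace K (Cl K n) where
  norm_smul_le r a := by
    change ‖coords K n (r • a)‖ ≤ ‖r‖ * ‖coords K n a‖
    rw [map_smul, norm_smul]

noncomputable instance : NormedSpace ℝ (Cl K n) where
  norm_smul_le r a := by
    have h : r • a = (r : K) • a := by
      rw [← algebraMap_smul K r a]
    rw [h, norm_smul, RCLike.norm_ofReal, Real.norm_eq_abs]

instance : FiniteDimensional K (Cl K n) := (basis K n).finiteDimensional_of_finite

instance : ContinuousMul (Cl K n) where
  continuous_mul := by
    let B : Cl K n →ₗ[K] Cl K n →L[K] Cl K n :=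
      (LinearMap.toContinuousLinearMap (𝕜 := K) (E := Cl K n) (F' := Cl K n)).toLinearMap.comp
        (LinearMap.mul K (Cl K n))
    have hB : Continuous B := B.continuous_of_finiteDimensional
    exact (hB.comp continuous_fst).clm_apply continuous_snd

end Norm

end Cl

/-- The symmetric product `a₁ × ⋯ × aₖ = (1 / k!) ∑_σ a_{σ(1)} ⋯ a_{σ(k)}`, the sum being over all
permutations `σ` of `k` letters. The empty product is `1`. -/
noncomputable def symProd (F : Type*) [Field F] {R : Type*} [Ring R] [Algebra F R] {k : ℕ}
    (a : Fin k → R) : R :=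
  (k ! : F)⁻¹ • ∑ σ : Equiv.Perm (Fin k), (List.ofFn fun i => a (σ i)).prod

/-- The list `1, …, 1, 2, …, 2, …, m, …, m` in which the index `j` occurs `αⱼ` times. -/
def indexList {m : ℕ} (α : Fin m → ℕ) : List (Fin m) :=
  (List.finRange m).flatMap fun j => List.replicate (α j) j

/-- `a₁^{α₁} × ⋯ × aₘ^{αₘ}`: the symmetric product of `α₁` factors `a₁`, …, `αₘ` factors `aₘ`. -/
noncomputable def symPow (F : Type*) [Field F] {R : Type*} [Ring R] [Algebra F R] {m : ℕ}
    (a : Fin m → R) (α : Fin m → ℕ) : R :=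
  symProd F fun i : Fin (indexList α).length => a ((indexList α).get i)

/-- The real Euclidean space of the points `x = (x₀, x₁, …, xₘ)`. -/
abbrev RSpace (m : ℕ) : Type := EuclideanSpace ℝ (Fin (m + 1))

section Hyperholomorphic

variable (K : Type*) [RCLike K] {m n : ℕ} (hmn : m ≤ n)

/-- The Dirac operator `D f = ∑_{j=0}^m eⱼ ∂f/∂xⱼ`, with `e₀ = 1`. -/
noncomputable def dirac (f : RSpace m → Cl K n) (x : RSpace m) : Cl K n :=
  fderiv ℝ f x (EuclideanSpace.single 0 1) +
    ∑ j : Fin m, Cl.e K (Fin.castLE hmn j) * fderiv ℝ f x (EuclideanSpace.single j.succ 1)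

/-- The space of all functions that are hyperholomorphic on the whole space, that is, the
continuously differentiable solutions of `D f = 0`. As a subspace of `C(RSpace m, Cl K n)` it
carries the compact-open topology, i.e. the topology of uniform convergence on compact sets. -/
noncomputable def hyperholomorphic : Submodule K C(RSpace m, Cl K n) where
  carrier := {f | ContDiff ℝ 1 f ∧ ∀ x, dirac K hmn f x = 0}
  zero_mem' := by
    refine ⟨?_, fun x => ?_⟩
    · rw [ContinuousMap.coe_zero]
      exact contDiff_const
    · simp [dirac]
  add_mem' := by
    rintro f g ⟨hf, hf0⟩ ⟨hg, hg0⟩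
    refine ⟨hf.add hg, fun x => ?_⟩
    have h : fderiv ℝ (⇑(f + g)) x = fderiv ℝ f x + fderiv ℝ g x :=
      fderiv_add (hf.differentiable one_ne_zero x) (hg.differentiable one_ne_zero x)
    have h1 := hf0 x
    have h2 := hg0 x
    simp only [dirac] at h1 h2 ⊢
    simp only [h, add_apply, mul_add, Finset.sum_add_distrib]
    rw [add_add_add_comm, h1, h2, add_zero]
  smul_mem' := by
    rintro r f ⟨hf, hf0⟩
    have key : ∀ x v, fderiv ℝ (⇑(r • f)) x v = r • fderiv ℝ f x v := by
      intro x v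
      have h := ((r • ContinuousLinearMap.id K (Cl K n)).restrictScalars ℝ).hasFDerivAt.comp x
        (hf.differentiable one_ne_zero x).hasFDerivAt
      have h' : fderiv ℝ (⇑(r • f)) x = _ := h.fderiv
      rw [h']
      rfl
    refine ⟨((r • ContinuousLinearMap.id K (Cl K n)).restrictScalars ℝ).contDiff.comp hf,
      fun x => ?_⟩
    have h1 := hf0 x
    simp only [dirac] at h1 ⊢
    simp only [key, mul_smul_comm, ← Finset.smul_sum, ← smul_add, h1, smul_zero]

/-- The regular variable `eⱼ x₀ - e₀ xⱼ`, `1 ≤ j ≤ m` (here `j : Fin m` is counted from `0`). -/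
noncomputable def regVar (j : Fin m) (x : RSpace m) : Cl K n :=
  x 0 • Cl.e K (Fin.castLE hmn j) - x j.succ • 1

/-- The symmetric polynomial `V_α(x)`: the symmetric product of the regular variables, the `j`-th
one taken `αⱼ` times. -/
noncomputable def fueterPoly (α : Fin m → ℕ) (x : RSpace m) : Cl K n :=
  symPow K (fun j => regVar K hmn j x) α

theorem continuous_regVar (j : Fin m) : Continuous (regVar K hmn j) := by
  unfold regVar
  fun_prop

theorem continuous_fueterPoly (α : Fin m → ℕ) : Continuous (fueterPoly K hmn α) := by
  unfold fueterPoly symPow symProd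
  refine Continuous.fun_const_smul ?_ _
  refine continuous_finsetSum (M := Cl K n) _ fun σ _ => ?_
  simp only [List.ofFn_eq_map]
  exact continuous_list_prod (M := Cl K n) _ fun i _ => continuous_regVar K hmn _

/-- The function `x ↦ V_α(x) c`, with the Clifford coefficient `c` written on the right. -/
noncomputable def fueterTerm (α : Fin m → ℕ) (c : Cl K n) : C(RSpace m, Cl K n) :=
  ⟨fun x => fueterPoly K hmn α x * c, (continuous_fueterPoly K hmn α).mul continuous_const⟩

end Hyperholomorphic

/-- `Φ` is a hyperholomorphic functional calculus on the whole space for the tuple `T` of operators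
on `H`. It is a continuous linear map from the space of entire hyperholomorphic functions to the
bounded operators on `H ⊗ H₀` (operator norm), where `H₀` carries the representation `ρ` of the
Clifford algebra. It sends the regular variables `eⱼ x₀ - e₀ xⱼ` to `Tⱼ` (that is, `Tⱼ ⊗ I`), their
symmetric products to the symmetric products of the operators, and it respects Clifford
coefficients written on the right. -/
structure IsHyperholomorphicCalculus {K 𝕜 : Type*} [RCLike K] [RCLike 𝕜] [NormedAlgebra K 𝕜]
    {m n : ℕ} (hmn : m ≤ n)
    {H : Type*} [NormedAddCommGroup H] [InnerProductSpace 𝕜 H]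
    {H₀ : Type*} [NormedAddCommGroup H₀] [InnerProductSpace 𝕜 H₀]
    (T : Fin m → H →L[𝕜] H) (ρ : Cl K n →+* (H₀ →L[𝕜] H₀))
    (Φ : hyperholomorphic K hmn →SL[algebraMap K 𝕜] (H ⊗[𝕜] H₀ →L[𝕜] H ⊗[𝕜] H₀)) : Prop where
  map_regVar : ∀ j : Fin m, ∃ f : hyperholomorphic K hmn,
    (∀ x, f.1 x = regVar K hmn j x) ∧ Φ f = TensorProduct.mapL (T j) 1
  map_symProd : ∀ (k : ℕ) (j : Fin k → Fin m), ∃ f : hyperholomorphic K hmn,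
    (∀ x, f.1 x = symProd K fun i => regVar K hmn (j i) x) ∧
      Φ f = symProd 𝕜 fun i => TensorProduct.mapL (T (j i)) 1
  map_mul_right : ∀ (f : hyperholomorphic K hmn) (c : Cl K n), ∃ g : hyperholomorphic K hmn,
    (∀ x, g.1 x = f.1 x * c) ∧ Φ g = Φ f * TensorProduct.mapL 1 (ρ c)

/-!
The calculus is obtained by substituting `Tⱼ` for `eⱼ x₀ - xⱼ` in the Taylor series of an entire
hyperholomorphic function.

*Mean value property.* Let `φ` be a smooth radial bump function and `D f = 0`. Expanding `ȳ D f` and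
using `ēᵢ eₖ + ēₖ eᵢ = 2 δᵢₖ`, the radial derivative of `f` differs from `0` only by Clifford
multiples of the rotation fields `yᵢ ∂ₖ - yₖ ∂ᵢ`, which integrate to zero against `φ`. Hence
`∫ φ(y) f(x + t y) dy` does not depend on `t` (`integral_radialBump_smul_add_smul`). It follows that
`f` is smooth (`contDiff_of_dirac_eq_zero`) and, by an integration by parts, that
`|∂ᵥ f(x)| ≤ C |v| / r · sup |f|` over the ball of radius `r` around `x`
(`exists_norm_fderiv_apply_le`). Derivatives of `f` are again hyperholomorphic, so iterating this
gives Cauchy estimates on balls of every radius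
(`exists_norm_list_prod_dirDeriv_div_factorial_le`), and `f` is the sum of its Taylor series
(`tendsto_taylor`).

*Expansion in regular variables.* Since `∂₀ f = -∑ eⱼ ∂ⱼ f`, the derivative of `f` in the direction
`x` is `-∑ⱼ (eⱼ x₀ - xⱼ) ∂ⱼ f`; iterating, the Taylor series becomes a series over all words in the
letters `1, …, m` (`dirDeriv_pow_apply`), which converges absolutely because the Cauchy estimates
beat every geometric sequence (`hasSum_wordTerm`). The partial derivatives commute, so the words
with the same content have the same coefficient, and summing their products gives a multiple of the
symmetric product (`sum_wordsOfContent_prod`). This is the series in the `V_α`. On `x₀ = 0` it is a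
real power series, which determines its coefficients (`eq_of_hasSum_fueterPoly`).

*Operators.* The same estimates make the operator series converge absolutely and bound it by the
supremum of `f` on one ball (`exists_norm_tsum_opTerm_le`), which is continuity. Its algebraic
properties follow from the uniqueness of the coefficients, once it is known that symmetric products
of regular variables are hyperholomorphic. By polarization this reduces to powers of
`∑ tⱼ (eⱼ x₀ - xⱼ)`, whose values commute with `∑ tⱼ eⱼ`
(`exists_hyperholomorphic_eq_symProd_regVar`).
-/

/-! ### Radial averages -/

section Bump

open MeasureTheory Metric Set Filter Topology

variable {m : ℕ}

/-- A smooth radial bump function supported in the closed unit ball. -/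
noncomputable def radialBump (y : RSpace m) : ℝ := Real.smoothTransition (1 - ‖y‖ ^ 2)

theorem contDiff_radialBump {k : ℕ∞} : ContDiff ℝ k (radialBump (m := m)) :=
  Real.smoothTransition.contDiff.comp (contDiff_const.sub (contDiff_norm_sq ℝ))

theorem continuous_radialBump : Continuous (radialBump (m := m)) :=
  (contDiff_radialBump (k := 0)).continuous

theorem differentiable_radialBump : Differentiable ℝ (radialBump (m := m)) :=
  (contDiff_radialBump (k := 1)).differentiable (by simp)

theorem radialBump_nonneg (y : RSpace m) : 0 ≤ radialBump y := Real.smoothTransition.nonneg _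

theorem radialBump_neg (y : RSpace m) : radialBump (-y) = radialBump y := by
  simp [radialBump]

theorem radialBump_eq_zero {y : RSpace m} (hy : 1 ≤ ‖y‖) : radialBump y = 0 :=
  Real.smoothTransition.zero_of_nonpos (by nlinarith)

theorem hasCompactSupport_radialBump : HasCompactSupport (radialBump (m := m)) :=
  HasCompactSupport.intro (isCompact_closedBall (0 : RSpace m) 1) fun y hy =>
    radialBump_eq_zero (by simpa using (not_le.1 (by simpa using hy)).le)

theorem integral_radialBump_pos : 0 < ∫ y : RSpace m, radialBump y :=
  continuous_radialBump.integral_pos_of_hasCompactSupport_nonneg_nonzero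
    hasCompactSupport_radialBump radialBump_nonneg (x := 0) (by simp [radialBump])

/-- The gradient of a radial function is radial. -/
theorem fderiv_radialBump_apply (y v : RSpace m) :
    fderiv ℝ radialBump y v
      = -2 * deriv Real.smoothTransition (1 - ‖y‖ ^ 2) * inner ℝ y v := by
  have h1 : HasFDerivAt (fun y : RSpace m => 1 - ‖y‖ ^ 2) (-(2 • innerSL ℝ y)) y :=
    (hasStrictFDerivAt_norm_sq y).hasFDerivAt.const_sub 1
  have h2 : HasDerivAt Real.smoothTransition _ (1 - ‖y‖ ^ 2) :=
    ((Real.smoothTransition.contDiff (n := 1)).differentiable (by simp) _).hasDerivAt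
  have h3 : HasFDerivAt (radialBump (m := m)) _ y := h2.comp_hasFDerivAt y h1
  rw [h3.fderiv]
  simp
  ring

theorem fderiv_radialBump_eq_zero {y : RSpace m} (hy : 1 < ‖y‖) : fderiv ℝ radialBump y = 0 := by
  have : radialBump =ᶠ[𝓝 y] fun _ => (0 : ℝ) := by
    filter_upwards [(isOpen_lt continuous_const continuous_norm).mem_nhds hy] with z hz
    exact radialBump_eq_zero (le_of_lt hz)
  rw [this.fderiv_eq]
  simp

end Bump

section RadialIntegrals

open MeasureTheory Metric Set Filter Topology

variable {m : ℕ} {F : Type*} [NormedAddCommGroup F] [NormedSpace ℝ F]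

theorem integrable_smul_of_radialBump {u : RSpace m → ℝ} (hu : Continuous u)
    {g : RSpace m → F} (hg : Continuous g) :
    Integrable fun y => (radialBump y * u y) • g y :=
  ((continuous_radialBump.mul hu).smul hg).integrable_of_hasCompactSupport
    (hasCompactSupport_radialBump.mul_right.smul_right)

/-- The rotation fields `yᵢ ∂ₖ - yₖ ∂ᵢ` annihilate radial functions, so integrated against a radial
weight they give zero. -/
theorem integral_radialBump_mul_coord_smul_fderiv_comm {G : RSpace m → F} (hG : ContDiff ℝ 1 G)
    (i k : Fin (m + 1)) :
    ∫ y, (radialBump y * y i) • fderiv ℝ G y (EuclideanSpace.single k 1) =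
      ∫ y, (radialBump y * y k) • fderiv ℝ G y (EuclideanSpace.single i 1) := by
  have hc (j : Fin (m + 1)) : Continuous fun y : RSpace m => y j := by fun_prop
  have hG' : Continuous (fderiv ℝ G) := hG.continuous_fderiv (by simp)
  have hGv (v : RSpace m) : Continuous fun y => fderiv ℝ G y v := hG'.clm_apply continuous_const
  have hu (j : Fin (m + 1)) : ContDiff ℝ 1 fun y : RSpace m => radialBump y * y j :=
    (contDiff_radialBump (k := 1)).mul (by fun_prop)
  have hd (j l : Fin (m + 1)) (y : RSpace m) :
      fderiv ℝ (fun y : RSpace m => radialBump y * y j) y (EuclideanSpace.single l 1)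
        = radialBump y * (if j = l then 1 else 0)
          + y j * (-2 * deriv Real.smoothTransition (1 - ‖y‖ ^ 2) * y l) := by
    have h1 : HasFDerivAt (fun y : RSpace m => y j) (EuclideanSpace.proj (𝕜 := ℝ) j) y :=
      (EuclideanSpace.proj (𝕜 := ℝ) j).hasFDerivAt
    rw [((differentiable_radialBump y).hasFDerivAt.fun_mul h1).fderiv]
    simp [fderiv_radialBump_apply, EuclideanSpace.inner_single_right]
  have key (j l : Fin (m + 1)) :
      ∫ y, (radialBump y * y j) • fderiv ℝ G y (EuclideanSpace.single l 1) =
        -∫ y, fderiv ℝ (fun y : RSpace m => radialBump y * y j) y (EuclideanSpace.single l 1)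
          • G y := by
    refine integral_smul_fderiv_eq_neg_fderiv_smul_of_integrable ?_
      (integrable_smul_of_radialBump (hc j) (hGv _))
      (integrable_smul_of_radialBump (hc j) hG.continuous)
      (fun x _ => (hu j).differentiable (by simp) x) (fun x _ => hG.differentiable (by simp) x)
    refine Continuous.integrable_of_hasCompactSupport
      ((((hu j).continuous_fderiv (by simp)).clm_apply continuous_const).smul hG.continuous) ?_
    refine HasCompactSupport.smul_right ?_
    exact (hasCompactSupport_radialBump.mul_right (f' := fun y : RSpace m => y j)).fderiv_apply
      (𝕜 := ℝ) _
  rw [key, key]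
  congr 2
  ext y
  rw [hd, hd]
  congr 1
  simp only [eq_comm (a := i)]
  ring

/-- Differentiation under the integral sign for the radial averages of `f` around `x`. -/
theorem hasDerivAt_integral_radialBump_smul {f : RSpace m → F} (hf : ContDiff ℝ 1 f)
    (x : RSpace m) (t : ℝ) :
    HasDerivAt (fun s : ℝ => ∫ y, radialBump y • f (x + s • y))
      (∫ y, radialBump y • fderiv ℝ f (x + t • y) y) t := by
  have hf' : Continuous (fderiv ℝ f) := hf.continuous_fderiv (by simp)
  have hcont : Continuous fun p : ℝ × RSpace m => radialBump p.2 • fderiv ℝ f (x + p.1 • p.2) p.2 :=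
    (continuous_radialBump.comp continuous_snd).smul
      ((hf'.comp (by fun_prop)).clm_apply continuous_snd)
  obtain ⟨B, hB⟩ := ((isCompact_closedBall t 1).prod
    (isCompact_closedBall (0 : RSpace m) 1)).exists_bound_of_continuousOn hcont.continuousOn
  have hint (s : ℝ) : Continuous fun y : RSpace m => radialBump y • f (x + s • y) :=
    continuous_radialBump.smul (hf.continuous.comp (by fun_prop))
  refine (hasDerivAt_integral_of_dominated_loc_of_deriv_le
    (F := fun s y => radialBump y • f (x + s • y))
    (F' := fun s y => radialBump y • fderiv ℝ f (x + s • y) y)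
    (bound := (closedBall (0 : RSpace m) 1).indicator fun _ => B)
    (closedBall_mem_nhds t one_pos) ?_ ?_ ?_ ?_ ?_ ?_).2
  · exact Eventually.of_forall fun s => (hint s).aestronglyMeasurable
  · exact (hint t).integrable_of_hasCompactSupport hasCompactSupport_radialBump.smul_right
  · exact (hcont.comp (by fun_prop : Continuous fun y : RSpace m => (t, y))).aestronglyMeasurable
  · refine Eventually.of_forall fun y s hs => ?_
    by_cases hy : y ∈ closedBall (0 : RSpace m) 1
    · rw [indicator_of_mem hy]
      exact hB (s, y) ⟨hs, hy⟩
    · rw [indicator_of_notMem hy, radialBump_eq_zero (by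
        simpa using (not_le.1 (by simpa using hy)).le)]
      simp
  · exact (integrable_indicator_iff isClosed_closedBall.measurableSet).2
      (integrableOn_const (isCompact_closedBall _ _).measure_lt_top.ne)
  · refine Eventually.of_forall fun y s _ => ?_
    have h1 : HasDerivAt (fun s : ℝ => x + s • y) y s := by
      simpa using ((hasDerivAt_id s).smul_const y).const_add x
    exact ((hf.differentiable (by simp) _).hasFDerivAt.comp_hasDerivAt s h1).const_smul _

end RadialIntegrals

/-! ### The mean value property and the gradient estimate -/

section CliffordMul

open MeasureTheory Metric Set Filter Topology

variable (K : Type*) [RCLike K] (n : ℕ)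

instance : FiniteDimensional ℝ (Cl K n) := FiniteDimensional.trans ℝ K (Cl K n)

instance : CompleteSpace (Cl K n) := FiniteDimensional.complete K (Cl K n)

/-- The multiplication of the Clifford algebra as a continuous real bilinear map. -/
noncomputable def Cl.mulL : Cl K n →L[ℝ] Cl K n →L[ℝ] Cl K n :=
  LinearMap.toContinuousLinearMap
    ((LinearMap.toContinuousLinearMap (𝕜 := ℝ) (E := Cl K n) (F' := Cl K n)).toLinearMap.comp
      (LinearMap.mul ℝ (Cl K n)))

variable {K n}

@[simp]
theorem Cl.mulL_apply (a b : Cl K n) : Cl.mulL K n a b = a * b := rfl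

/-- The Euclidean norm of the Clifford algebra is submultiplicative up to a constant. -/
theorem Cl.exists_norm_mul_le (K : Type*) [RCLike K] (n : ℕ) :
    ∃ A : ℝ, 1 ≤ A ∧ ∀ a b : Cl K n, ‖a * b‖ ≤ A * ‖a‖ * ‖b‖ := by
  refine ⟨max 1 ‖Cl.mulL K n‖, le_max_left _ _, fun a b => ?_⟩
  refine ((Cl.mulL K n).le_opNorm₂ a b).trans ?_
  gcongr
  exact le_max_right _ _

end CliffordMul

section MeanValue

open MeasureTheory Metric Set Filter Topology

variable {K : Type*} [RCLike K] {m n : ℕ} (hmn : m ≤ n)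

/-- The units `e₀ = 1, e₁, …, eₘ`. -/
noncomputable def cliffordUnit : Fin (m + 1) → Cl K n :=
  Fin.cons 1 fun j => Cl.e K (Fin.castLE hmn j)

/-- The conjugate units `1, -e₁, …, -eₘ`. -/
noncomputable def cliffordConjUnit : Fin (m + 1) → Cl K n :=
  Fin.cons 1 fun j => -Cl.e K (Fin.castLE hmn j)

theorem cliffordConjUnit_mul_add (i k : Fin (m + 1)) :
    cliffordConjUnit (K := K) hmn i * cliffordUnit hmn k
      + cliffordConjUnit hmn k * cliffordUnit hmn i = if i = k then 2 else 0 := by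
  refine Fin.cases ?_ (fun i => ?_) i <;> refine Fin.cases ?_ (fun k => ?_) k
  · simp [cliffordConjUnit, cliffordUnit, one_add_one_eq_two]
  · simp [cliffordConjUnit, cliffordUnit, (Fin.succ_ne_zero _).symm]
  · simp [cliffordConjUnit, cliffordUnit]
  · simp only [cliffordConjUnit, cliffordUnit, Fin.cons_succ, neg_mul, Fin.succ_inj]
    split_ifs with h
    · subst h
      rw [Cl.e_mul_self, neg_neg, one_add_one_eq_two]
    · rw [← neg_add, Cl.e_mul_e_add_swap, neg_zero]
      simpa [Fin.ext_iff] using h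

theorem dirac_eq_sum (f : RSpace m → Cl K n) (x : RSpace m) :
    dirac K hmn f x
      = ∑ i, cliffordUnit hmn i * fderiv ℝ f x (EuclideanSpace.single i 1) := by
  simp [dirac, Fin.sum_univ_succ, cliffordUnit]

theorem fderiv_apply_eq_sum {F : Type*} [NormedAddCommGroup F] [NormedSpace ℝ F]
    (L : RSpace m →L[ℝ] F) (y : RSpace m) :
    L y = ∑ i, y i • L (EuclideanSpace.single i 1) := by
  conv_lhs => rw [← (EuclideanSpace.basisFun (Fin (m + 1)) ℝ).sum_repr y]
  simp

theorem fderiv_comp_add_smul_apply {F : Type*} [NormedAddCommGroup F] [NormedSpace ℝ F]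
    {f : RSpace m → F} (hf : Differentiable ℝ f) (x : RSpace m) (t : ℝ) (y v : RSpace m) :
    fderiv ℝ (fun y => f (x + t • y)) y v = t • fderiv ℝ f (x + t • y) v := by
  have h1 : HasFDerivAt (fun y : RSpace m => x + t • y)
      (t • ContinuousLinearMap.id ℝ (RSpace m)) y :=
    ((hasFDerivAt_id y).const_smul t).const_add x
  have h2 : fderiv ℝ (fun y => f (x + t • y)) y = _ :=
    ((hf (x + t • y)).hasFDerivAt.comp y h1).fderiv
  rw [h2]
  simp

/-- The radial derivative of a solution of `D G = 0` is orthogonal to radial weights: expanding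
`ȳ D G = ∑ ēᵢ eₖ yᵢ ∂ₖ G`, the off-diagonal terms are rotation fields, because
`ēᵢ eₖ + ēₖ eᵢ = 2 δᵢₖ`. -/
theorem integral_radialBump_smul_fderiv_self {G : RSpace m → Cl K n} (hG : ContDiff ℝ 1 G)
    (hD : ∀ x, dirac K hmn G x = 0) :
    ∫ y, radialBump y • fderiv ℝ G y y = 0 := by
  have hc (j : Fin (m + 1)) : Continuous fun y : RSpace m => y j := by fun_prop
  have hGv (v : RSpace m) : Continuous fun y => fderiv ℝ G y v :=
    (hG.continuous_fderiv (by simp)).clm_apply continuous_const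
  set q : Fin (m + 1) → Fin (m + 1) → Cl K n := fun i k =>
    ∫ y, (radialBump y * y i) • fderiv ℝ G y (EuclideanSpace.single k 1) with hq
  have hsymm (i k) : q i k = q k i := integral_radialBump_mul_coord_smul_fderiv_comm hG i k
  have hint (i k : Fin (m + 1)) : Integrable fun y : RSpace m =>
      (radialBump y * y i) • fderiv ℝ G y (EuclideanSpace.single k 1) :=
    integrable_smul_of_radialBump (hc i) (hGv _)
  have h1 : ∫ y, radialBump y • fderiv ℝ G y y = ∑ i, q i i := by
    rw [hq, ← integral_finsetSum _ fun i _ => hint i i]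
    congr 1
    ext y
    conv_lhs => rw [fderiv_apply_eq_sum (fderiv ℝ G y) y, Finset.smul_sum]
    simp only [smul_smul]
  have h2 (i) : ∑ k, cliffordUnit hmn k * q i k = 0 := by
    have hk (k : Fin (m + 1)) : cliffordUnit hmn k * q i k = ∫ y, (radialBump y * y i) •
        (cliffordUnit hmn k * fderiv ℝ G y (EuclideanSpace.single k 1)) := by
      rw [hq, ← Cl.mulL_apply, ← ContinuousLinearMap.integral_comp_comm _ (hint i k)]
      simp
    simp only [hk]
    rw [← integral_finsetSum]
    · simp only [← Finset.smul_sum, ← dirac_eq_sum hmn G, hD, smul_zero, integral_zero]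
    · intro k _
      have := (Cl.mulL K n (cliffordUnit hmn k)).integrable_comp (hint i k)
      simpa using this
  have h3 : ∑ i, ∑ k, (cliffordConjUnit hmn i * cliffordUnit hmn k) * q i k = 0 := by
    simp only [mul_assoc, ← Finset.mul_sum, h2, mul_zero, Finset.sum_const_zero]
  have h4 : (2 : ℝ) • ∑ i, q i i = 0 := by
    calc (2 : ℝ) • ∑ i, q i i
        = ∑ i, ∑ k, (if i = k then (2 : Cl K n) else 0) * q i k := by
          simp [Finset.smul_sum, two_smul, two_mul]
      _ = ∑ i, ∑ k, (cliffordConjUnit hmn i * cliffordUnit hmn k) * q i k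
          + ∑ i, ∑ k, (cliffordConjUnit hmn k * cliffordUnit hmn i) * q i k := by
          simp only [← cliffordConjUnit_mul_add hmn, add_mul, Finset.sum_add_distrib]
      _ = 0 := by
          rw [h3, Finset.sum_comm, zero_add]
          simp only [fun i k => hsymm k i]
          exact h3
  rw [h1]
  simpa using h4

/-- The derivative of the radial averages of a solution of `D f = 0` vanishes. -/
theorem integral_radialBump_smul_fderiv_add_smul {f : RSpace m → Cl K n} (hf : ContDiff ℝ 1 f)
    (hD : ∀ x, dirac K hmn f x = 0) (x : RSpace m) (t : ℝ) :
    ∫ y, radialBump y • fderiv ℝ f (x + t • y) y = 0 := by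
  rcases eq_or_ne t 0 with rfl | ht
  · -- At `t = 0` the integrand is odd.
    have h := integral_neg_eq_self (μ := (volume : Measure (RSpace m)))
      fun y => radialBump y • fderiv ℝ f x y
    simp only [radialBump_neg, map_neg, smul_neg, integral_neg] at h
    have h2 : (2 : ℝ) • ∫ y, radialBump y • fderiv ℝ f x y = 0 := by
      rw [two_smul]
      nth_rewrite 1 [← h]
      exact neg_add_cancel _
    simpa using h2
  · have hG : ContDiff ℝ 1 fun y => f (x + t • y) := hf.comp (by fun_prop)
    have hGd (y v : RSpace m) :
        fderiv ℝ (fun y => f (x + t • y)) y v = t • fderiv ℝ f (x + t • y) v :=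
        fderiv_comp_add_smul_apply (hf.differentiable (by simp)) x t y v
    have h := integral_radialBump_smul_fderiv_self hmn hG fun y => by
      have := hD (x + t • y)
      rw [dirac_eq_sum] at this ⊢
      simp only [hGd, mul_smul_comm, ← Finset.smul_sum, this, smul_zero]
    simp only [hGd, smul_comm _ t, integral_smul] at h
    exact (smul_eq_zero.1 h).resolve_left ht

/-- The mean value property of solutions of `D f = 0`. -/
theorem integral_radialBump_smul_add_smul {f : RSpace m → Cl K n} (hf : ContDiff ℝ 1 f)
    (hD : ∀ x, dirac K hmn f x = 0) (x : RSpace m) (t : ℝ) :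
    ∫ y, radialBump y • f (x + t • y) = (∫ y : RSpace m, radialBump y) • f x := by
  have hd (s : ℝ) : HasDerivAt (fun s : ℝ => ∫ y, radialBump y • f (x + s • y)) 0 s := by
    simpa only [integral_radialBump_smul_fderiv_add_smul hmn hf hD x s] using
      hasDerivAt_integral_radialBump_smul hf x s
  rw [is_const_of_deriv_eq_zero (fun s => (hd s).differentiableAt) (fun s => (hd s).deriv) t 0]
  simp [integral_smul_const]

/-- Solutions of `D f = 0` are smooth, being convolutions with a smooth bump function. -/
theorem contDiff_of_dirac_eq_zero {f : RSpace m → Cl K n} (hf : ContDiff ℝ 1 f)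
    (hD : ∀ x, dirac K hmn f x = 0) (k : ℕ∞) : ContDiff ℝ k f := by
  have h := hasCompactSupport_radialBump.contDiff_convolution_left (μ := volume)
    (ContinuousLinearMap.lsmul ℝ ℝ) (contDiff_radialBump (m := m) (k := k))
    hf.continuous.locallyIntegrable
  have h' : f = fun x => (∫ y : RSpace m, radialBump y)⁻¹ •
      convolution radialBump f (ContinuousLinearMap.lsmul ℝ ℝ) volume x := by
    ext1 x
    have := integral_radialBump_smul_add_smul hmn hf hD x (-1)
    simp only [neg_one_smul, ← sub_eq_add_neg] at this
    simp only [convolution, ContinuousLinearMap.lsmul_apply, this,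
      inv_smul_smul₀ integral_radialBump_pos.ne']
  rw [h']
  exact h.const_smul _

theorem dirac_fderiv_apply {f : RSpace m → Cl K n} (hf : ContDiff ℝ 1 f)
    (hD : ∀ x, dirac K hmn f x = 0) (v x : RSpace m) :
    dirac K hmn (fun x => fderiv ℝ f x v) x = 0 := by
  have hf2 : ContDiff ℝ 2 f := contDiff_of_dirac_eq_zero hmn hf hD 2
  have hd : DifferentiableAt ℝ (fderiv ℝ f) x :=
    (hf2.fderiv_right (m := 1) (by norm_num)).differentiable (by simp) x
  have hv (u w : RSpace m) : fderiv ℝ (fun x => fderiv ℝ f x u) x w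
      = fderiv ℝ (fderiv ℝ f) x w u := by
    rw [fderiv_clm_apply hd (differentiableAt_const u)]
    simp
  have hsymm (u w : RSpace m) : fderiv ℝ (fderiv ℝ f) x w u = fderiv ℝ (fderiv ℝ f) x u w :=
    (hf2.contDiffAt.isSymmSndFDerivAt (by simp)) w u
  rw [dirac_eq_sum]
  simp only [hv, hsymm v]
  have h0 : (fun x => ∑ i, cliffordUnit hmn i * fderiv ℝ f x (EuclideanSpace.single i 1))
      = fun _ => 0 := by
    ext1 x
    rw [← dirac_eq_sum, hD]
  have h1 : HasFDerivAt
      (fun x => ∑ i, cliffordUnit hmn i * fderiv ℝ f x (EuclideanSpace.single i 1))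
      (∑ i, (Cl.mulL K n (cliffordUnit hmn i)).comp
        (fderiv ℝ (fun x => fderiv ℝ f x (EuclideanSpace.single i 1)) x)) x := by
    refine HasFDerivAt.fun_sum fun i _ => ?_
    exact (Cl.mulL K n (cliffordUnit hmn i)).hasFDerivAt.comp x
      (hd.clm_apply (differentiableAt_const _)).hasFDerivAt
  rw [h0] at h1
  have h2 := DFunLike.congr_fun (h1.unique (hasFDerivAt_const 0 x)) v
  simpa [hv] using h2

/-- The interior gradient estimate: differentiate the mean value property and integrate by parts. -/
theorem exists_norm_fderiv_apply_le (m : ℕ) : ∃ C : ℝ, 0 < C ∧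
    ∀ {K : Type*} [RCLike K] {n : ℕ} (hmn : m ≤ n) {f : RSpace m → Cl K n},
      ContDiff ℝ 1 f → (∀ x, dirac K hmn f x = 0) → ∀ (x v : RSpace m) {r M : ℝ}, 0 < r →
      (∀ z ∈ closedBall x r, ‖f z‖ ≤ M) → ‖fderiv ℝ f x v‖ ≤ C * ‖v‖ / r * M := by
  have hφ' : Continuous (fderiv ℝ (radialBump (m := m))) :=
    (contDiff_radialBump (k := 1)).continuous_fderiv (by simp)
  have hφs : HasCompactSupport (fderiv ℝ (radialBump (m := m))) :=
    hasCompactSupport_radialBump.fderiv (𝕜 := ℝ)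
  set c := ∫ y : RSpace m, radialBump y with hc
  have hc0 : 0 < c := integral_radialBump_pos
  set d := ∫ y : RSpace m, ‖fderiv ℝ radialBump y‖ with hd
  have hd0 : 0 ≤ d := integral_nonneg fun y => norm_nonneg _
  refine ⟨(d + 1) / c, by positivity, fun {K} _ {n} hmn {f} hf hD x v {r M} hr hM => ?_⟩
  have hM0 : 0 ≤ M := (norm_nonneg _).trans (hM x (mem_closedBall_self hr.le))
  have hf2 : ContDiff ℝ 2 f := contDiff_of_dirac_eq_zero hmn hf hD 2
  have hfv : ContDiff ℝ 1 fun x => fderiv ℝ f x v :=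
    (hf2.fderiv_right (m := 1) (by norm_num)).clm_apply contDiff_const
  have h1 := integral_radialBump_smul_add_smul hmn hfv (dirac_fderiv_apply hmn hf hD v) x r
  have hG : ContDiff ℝ 1 fun y => f (x + r • y) := hf.comp (by fun_prop)
  have hGd (y : RSpace m) :
      fderiv ℝ (fun y => f (x + r • y)) y v = r • fderiv ℝ f (x + r • y) v :=
      fderiv_comp_add_smul_apply (hf.differentiable (by simp)) x r y v
  have h2 : ∫ y, radialBump y • fderiv ℝ (fun y => f (x + r • y)) y v
      = -∫ y, fderiv ℝ radialBump y v • f (x + r • y) := by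
    refine integral_smul_fderiv_eq_neg_fderiv_smul_of_integrable ?_ ?_ ?_
      (fun y _ => differentiable_radialBump y) (fun y _ => hG.differentiable (by simp) y)
    · refine Continuous.integrable_of_hasCompactSupport
        ((hφ'.clm_apply continuous_const).smul hG.continuous) ?_
      exact (hasCompactSupport_radialBump.fderiv_apply (𝕜 := ℝ) v).smul_right
    · exact Continuous.integrable_of_hasCompactSupport (continuous_radialBump.smul
        ((hG.continuous_fderiv (by simp)).clm_apply continuous_const))
        hasCompactSupport_radialBump.smul_right
    · exact Continuous.integrable_of_hasCompactSupport (continuous_radialBump.smul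
        hG.continuous) hasCompactSupport_radialBump.smul_right
  simp only [hGd, smul_comm _ r, integral_smul, h1, ← hc] at h2
  have h3 : ‖∫ y, fderiv ℝ radialBump y v • f (x + r • y)‖ ≤ d * (‖v‖ * M) := by
    rw [hd, ← integral_mul_const]
    refine norm_integral_le_of_norm_le
      ((hφ'.norm.integrable_of_hasCompactSupport hφs.norm).mul_const _)
      (Eventually.of_forall fun y => ?_)
    rw [norm_smul]
    rcases le_or_gt ‖y‖ 1 with hy | hy
    · have h5 : ‖f (x + r • y)‖ ≤ M := hM _ (by
        simp only [mem_closedBall, dist_self_add_left, norm_smul, Real.norm_of_nonneg hr.le]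
        nlinarith)
      calc ‖fderiv ℝ radialBump y v‖ * ‖f (x + r • y)‖
          ≤ (‖fderiv ℝ radialBump y‖ * ‖v‖) * M := by
            gcongr
            exact (fderiv ℝ radialBump y).le_opNorm v
        _ = _ := by ring
    · simp [fderiv_radialBump_eq_zero hy]
  have h4 : r * (c * ‖fderiv ℝ f x v‖) ≤ d * (‖v‖ * M) := by
    rw [← norm_neg, ← h2, norm_smul, norm_smul, Real.norm_of_nonneg hr.le,
      Real.norm_of_nonneg hc0.le] at h3
    exact h3
  have h5 : ‖fderiv ℝ f x v‖ ≤ d * (‖v‖ * M) / (r * c) := by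
    rw [le_div_iff₀ (by positivity)]
    linarith
  refine h5.trans ?_
  rw [show (d + 1) / c * ‖v‖ / r * M = (d + 1) * (‖v‖ * M) / (r * c) by field_simp]
  gcongr
  linarith

end MeanValue

/-! ### Words and symmetric products -/

section Words

variable {m : ℕ}

/-- The content of a word `w` in the letters `1, …, m`: the number of occurrences of each letter. -/
def wordContent {k : ℕ} (w : Fin k → Fin m) (j : Fin m) : ℕ := Fintype.card {i // w i = j}

theorem sum_wordContent {k : ℕ} (w : Fin k → Fin m) : ∑ j, wordContent w j = k := by
  have := Fintype.card_congr (Equiv.sigmaFiberEquiv w)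
  rw [Fintype.card_sigma, Fintype.card_fin] at this
  exact this

theorem exists_perm_of_wordContent_eq {k : ℕ} {w w' : Fin k → Fin m}
    (h : wordContent w = wordContent w') : ∃ σ : Equiv.Perm (Fin k), w = w' ∘ σ := by
  refine ⟨Equiv.ofFiberEquiv (f := w) (g := w')
    fun j => Fintype.equivOfCardEq (congrFun h j), ?_⟩
  ext1 i
  exact (Equiv.ofFiberEquiv_map _ i).symm

theorem wordContent_comp_perm {k : ℕ} (w : Fin k → Fin m) (σ : Equiv.Perm (Fin k)) :
    wordContent (w ∘ σ) = wordContent w := by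
  ext j
  exact Fintype.card_congr (σ.subtypeEquiv fun i => Iff.rfl)

theorem count_indexList (α : Fin m → ℕ) (j : Fin m) : (indexList α).count j = α j := by
  have h := List.nodup_finRange m
  simp only [indexList, List.count_flatMap]
  rw [List.sum_map_eq_nsmul_single j]
  · simp [List.count_eq_one_of_mem h (List.mem_finRange j)]
  · intro i hi _
    simp [List.count_replicate, hi]

theorem wordContent_get (l : List (Fin m)) (j : Fin m) : wordContent l.get j = l.count j := by
  rw [wordContent, Fintype.card_subtype]
  conv_rhs => rw [← List.ofFn_get l, ← Multiset.coe_count, List.ofFn_eq_map, ← Multiset.map_coe,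
    Multiset.count_map]
  simp only [eq_comm (a := j)]
  rfl

theorem wordContent_get_indexList (α : Fin m → ℕ) : wordContent (indexList α).get = α :=
  funext fun j => by rw [wordContent_get, count_indexList]

theorem length_indexList (α : Fin m → ℕ) : (indexList α).length = ∑ j, α j := by
  rw [← sum_wordContent (indexList α).get, wordContent_get_indexList]

end Words

section SymProd

variable (F : Type*) [Field F] {R : Type*} [Ring R] [Algebra F R] {m : ℕ}

theorem symProd_comp_perm {k : ℕ} (a : Fin k → R) (σ : Equiv.Perm (Fin k)) :
    symProd F (fun i => a (σ i)) = symProd F a := by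
  unfold symProd
  congr 1
  exact Fintype.sum_equiv (Equiv.mulLeft σ) _ _ fun τ => rfl

theorem symProd_eq_symPow (a : Fin m → R) {k : ℕ} (w : Fin k → Fin m) :
    symProd F (fun i => a (w i)) = symPow F a (wordContent w) := by
  generalize hα : wordContent w = α
  obtain rfl : k = (indexList α).length := by rw [length_indexList, ← hα, sum_wordContent]
  obtain ⟨σ, hσ⟩ := exists_perm_of_wordContent_eq (w := w) (w' := (indexList α).get)
    (by rw [wordContent_get_indexList, hα])
  rw [hσ]
  exact symProd_comp_perm F (fun i => a ((indexList α).get i)) σ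

/-- The words with a prescribed content. Their length is forced. -/
abbrev WordsOfContent (α : Fin m → ℕ) : Type :=
  {w : Fin (indexList α).length → Fin m // wordContent w = α}

noncomputable instance (α : Fin m → ℕ) : Fintype (WordsOfContent α) := Fintype.ofFinite _

/-- The symmetric product is the mean of the products over all words of the given content: both
sides are averaged over the permutations of the letters. -/
theorem sum_wordsOfContent_prod [CharZero F] (a : Fin m → R) (α : Fin m → ℕ) :
    ∑ w : WordsOfContent α, (List.ofFn fun i => a (w.1 i)).prod
      = (Fintype.card (WordsOfContent α) : F) • symPow F a α := by
  have h1 : ∑ w : WordsOfContent α, symProd F (fun i => a (w.1 i))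
      = (Fintype.card (WordsOfContent α) : F) • symPow F a α := by
    rw [Finset.sum_congr rfl fun w _ => (symProd_eq_symPow F a w.1).trans (by rw [w.2]),
      Finset.sum_const, Finset.card_univ, Nat.cast_smul_eq_nsmul]
  rw [← h1]
  simp only [symProd]
  rw [← Finset.smul_sum, Finset.sum_comm]
  have h2 (σ : Equiv.Perm (Fin (indexList α).length)) :
      ∑ w : WordsOfContent α, (List.ofFn fun i => a (w.1 (σ i))).prod
        = ∑ w : WordsOfContent α, (List.ofFn fun i => a (w.1 i)).prod := by
    refine Fintype.sum_equiv ((σ.symm.arrowCongr (Equiv.refl (Fin m))).subtypeEquiv fun w => ?_)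
      _ _ fun w => rfl
    exact (wordContent_comp_perm w σ).symm ▸ Iff.rfl
  simp only [h2, Finset.sum_const, Finset.card_univ, Fintype.card_perm, Fintype.card_fin]
  rw [← Nat.cast_smul_eq_nsmul F, inv_smul_smul₀ (Nat.cast_ne_zero.2 (Nat.factorial_ne_zero _))]

theorem map_symProd {F' : Type*} [Field F'] {R' : Type*} [Ring R'] [Algebra F' R']
    (θ : R →+* R') {k : ℕ} (hθ : ∀ r : R, θ ((k ! : F)⁻¹ • r) = (k ! : F')⁻¹ • θ r)
    (a : Fin k → R) : θ (symProd F a) = symProd F' fun i => θ (a i) := by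
  unfold symProd
  rw [hθ, map_sum]
  simp only [map_list_prod, List.map_ofFn, Function.comp_def]

/-- Polarization: a symmetric product is a linear combination of powers. -/
theorem sum_perm_prod_eq_sum_pow [CharZero F] [DecidableEq F] {k : ℕ} (a : Fin k → R) :
    (2 : F) ^ k • ∑ σ : Equiv.Perm (Fin k), (List.ofFn fun i => a (σ i)).prod
      = ∑ ε ∈ Fintype.piFinset fun _ : Fin k => ({1, -1} : Finset F),
        (∏ i, ε i) • (∑ i, ε i • a i) ^ k := by
  have hne : (1 : F) ≠ -1 := by norm_num
  have hexp (ε : Fin k → F) : (∑ i, ε i • a i) ^ k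
      = ∑ w : Fin k → Fin k, (∏ i, ε (w i)) • (List.ofFn fun i => a (w i)).prod := by
    have h := (MultilinearMap.mkPiAlgebraFin F k R).map_sum
      (fun (_ : Fin k) (i : Fin k) => ε i • a i)
    rw [MultilinearMap.mkPiAlgebraFin_apply_const] at h
    simp only [MultilinearMap.map_smul_univ, MultilinearMap.mkPiAlgebraFin_apply] at h
    exact h
  -- The signs select the words in which every letter occurs an odd number of times, which are
  -- the permutations.
  have hsum (w : Fin k → Fin k) :
      ∑ ε ∈ Fintype.piFinset fun _ : Fin k => ({1, -1} : Finset F),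
        (∏ i, ε i) * ∏ i, ε (w i) = if Function.Bijective w then (2 : F) ^ k else 0 := by
    split_ifs with hw
    · have h1 : ∀ ε ∈ Fintype.piFinset fun _ : Fin k => ({1, -1} : Finset F),
          (∏ i, ε i) * ∏ i, ε (w i) = 1 := by
        intro ε hε
        rw [hw.prod_comp ε, ← Finset.prod_mul_distrib]
        refine Finset.prod_eq_one fun i _ => ?_
        have := Fintype.mem_piFinset.1 hε i
        simp only [Finset.mem_insert, Finset.mem_singleton] at this
        rcases this with h | h <;> simp [h]
      rw [Finset.sum_congr rfl h1]
      simp [Finset.card_pair hne]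
    · have hs : ¬ Function.Surjective w := fun h =>
        hw ⟨Finite.injective_iff_surjective.2 h, h⟩
      obtain ⟨j, hj⟩ := not_forall.1 hs
      have h1 (ε : Fin k → F) : (∏ i, ε i) * ∏ i, ε (w i)
          = ∏ i, ε i * ε i ^ Fintype.card {l // w l = i} := by
        rw [Finset.prod_mul_distrib]
        congr 1
        rw [← Finset.prod_fiberwise' Finset.univ w ε]
        simp [Fintype.card_subtype]
      simp only [h1]
      rw [← Finset.prod_univ_sum (fun _ : Fin k => ({1, -1} : Finset F))
        fun i x => x * x ^ Fintype.card {l // w l = i}]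
      refine Finset.prod_eq_zero (Finset.mem_univ j) ?_
      have : IsEmpty {l // w l = j} := ⟨fun l => hj ⟨l.1, l.2⟩⟩
      rw [Finset.sum_pair hne]
      simp
  simp only [hexp, Finset.smul_sum, smul_smul]
  rw [Finset.sum_comm]
  simp only [← Finset.sum_smul, hsum, ite_smul, zero_smul]
  rw [← Finset.sum_filter]
  symm
  exact Finset.sum_bij' (fun w hw => Equiv.ofBijective w (Finset.mem_filter.1 hw).2)
    (fun σ _ => ⇑σ) (fun _ _ => Finset.mem_univ _)
    (fun σ _ => Finset.mem_filter.2 ⟨Finset.mem_univ _, σ.bijective⟩) (fun _ _ => rfl)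
    (fun _ _ => Equiv.ext fun _ => rfl) (fun _ _ => rfl)

end SymProd

/-! ### Symmetric products of regular variables -/

section RegularProducts

variable {K : Type*} [RCLike K] {m n : ℕ} (hmn : m ≤ n)

variable (K) in
/-- The regular variable `eⱼ x₀ - e₀ xⱼ` as a continuous real linear map. -/
noncomputable def regVarL (j : Fin m) : RSpace m →L[ℝ] Cl K n :=
  (EuclideanSpace.proj (𝕜 := ℝ) (0 : Fin (m + 1))).smulRight (Cl.e K (Fin.castLE hmn j)) -
    (EuclideanSpace.proj (𝕜 := ℝ) j.succ).smulRight 1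

@[simp]
theorem regVarL_apply (j : Fin m) (x : RSpace m) : regVarL K hmn j x = regVar K hmn j x := rfl

/-- The derivative of the powers of a linear map whose values commute with each other. -/
theorem hasFDerivAt_pow_of_commute (Z : RSpace m →L[ℝ] Cl K n) (hZ : ∀ x y, Commute (Z x) (Z y))
    (k : ℕ) (x : RSpace m) :
    HasFDerivAt (fun x => Z x ^ (k + 1)) (((k : ℝ) + 1) • (Cl.mulL K n (Z x ^ k)).comp Z) x := by
  induction k with
  | zero =>
    simp only [zero_add, pow_one, pow_zero, Nat.cast_zero, one_smul]
    convert Z.hasFDerivAt using 1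
    ext v
    simp
  | succ k ih =>
    simp only [pow_succ _ (k + 1)]
    refine ((Cl.mulL K n).hasFDerivAt_of_bilinear ih Z.hasFDerivAt).congr_fderiv ?_
    ext1 v
    have h : Z x ^ k * Z v * Z x = Z x ^ (k + 1) * Z v := by
      rw [mul_assoc, (hZ v x).eq, ← mul_assoc, pow_succ]
    simp only [add_apply, ContinuousLinearMap.precompR_apply,
      ContinuousLinearMap.precompL_apply, ContinuousLinearMap.compL_apply, Cl.mulL_apply,
      smul_apply, ContinuousLinearMap.comp_apply, add_mul, smul_mul_assoc, h,
      Nat.cast_add, Nat.cast_one, add_smul,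
      one_smul]
    abel

/-- Powers of linear combinations of the regular variables are hyperholomorphic: with
`e = ∑ tⱼ eⱼ` they are powers of `x₀ e - ∑ tⱼ xⱼ`, which commutes with `e`. -/
theorem pow_sum_smul_regVar_mem (t : Fin m → K) (k : ℕ) :
    ContDiff ℝ 1 (fun x => (∑ j, t j • regVar K hmn j x) ^ k) ∧
      ∀ x, dirac K hmn (fun x => (∑ j, t j • regVar K hmn j x) ^ k) x = 0 := by
  set Z : RSpace m →L[ℝ] Cl K n := ∑ j, t j • regVarL K hmn j with hZdef
  have hZ (x) : ∑ j, t j • regVar K hmn j x = Z x := by simp [hZdef]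
  simp only [hZ]
  set e : Cl K n := ∑ j, t j • Cl.e K (Fin.castLE hmn j) with he
  have hZe (x : RSpace m) : ∃ s : K, Z x = x 0 • e - s • 1 := by
    refine ⟨∑ j, t j * (x j.succ : K), ?_⟩
    have h1 (r : ℝ) (a : Cl K n) : r • a = (r : K) • a := by rw [← algebraMap_smul K r a]
    rw [← hZ, he, Finset.smul_sum, Finset.sum_smul, ← Finset.sum_sub_distrib]
    refine Finset.sum_congr rfl fun j _ => ?_
    rw [regVar, smul_sub, smul_comm (t j) (x 0), h1 (x j.succ), smul_smul]
  have hcomm_e (x) : Commute e (Z x) := by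
    obtain ⟨s, hs⟩ := hZe x
    rw [hs]
    exact ((Commute.refl e).smul_right _).sub_right ((Commute.one_right e).smul_right s)
  have hcomm (x y) : Commute (Z x) (Z y) := by
    obtain ⟨s, hs⟩ := hZe x
    rw [hs]
    exact ((hcomm_e y).smul_left _).sub_left ((Commute.one_left _).smul_left s)
  cases k with
  | zero =>
    simp only [pow_zero]
    exact ⟨contDiff_const, fun x => by simp [dirac]⟩
  | succ k =>
    have hpow := hasFDerivAt_pow_of_commute Z hcomm
    constructor
    · induction k with
      | zero => simpa using Z.contDiff
      | succ k ih =>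
        simp only [pow_succ _ (k + 1)]
        exact ((Cl.mulL K n).isBoundedBilinearMap.contDiff).comp₂ ih Z.contDiff
    · intro x
      have hZ0 : Z (EuclideanSpace.single 0 1) = e := by
        rw [← hZ, he]
        simp [regVar]
      have hZs (j : Fin m) : Z (EuclideanSpace.single j.succ 1) = -(t j • 1) := by
        rw [← hZ, Finset.sum_eq_single j]
        · simp [regVar]
        · intro i _ hij
          simp [regVar, hij]
        · simp
      simp only [dirac, (hpow k x).fderiv, smul_apply,
        ContinuousLinearMap.comp_apply, Cl.mulL_apply, hZ0, hZs, mul_smul_comm, mul_neg, mul_one,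
        smul_neg, Finset.sum_neg_distrib, ← Finset.smul_sum, ← sub_eq_add_neg, ← smul_sub]
      rw [show ∑ j, t j • (Cl.e K (Fin.castLE hmn j) * Z x ^ k) = e * Z x ^ k by
        rw [he, Finset.sum_mul]
        simp only [smul_mul_assoc]]
      rw [((hcomm_e x).pow_right k).eq, sub_self, smul_zero]

/-- The symmetric product of regular variables, as an entire hyperholomorphic function. -/
theorem exists_hyperholomorphic_eq_symProd_regVar {k : ℕ} (w : Fin k → Fin m) :
    ∃ f : hyperholomorphic K hmn,
      ∀ x, f.1 x = symProd K fun i => regVar K hmn (w i) x := by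
  classical
  let pw (t : Fin m → K) : hyperholomorphic K hmn :=
    ⟨⟨fun x => (∑ j, t j • regVar K hmn j x) ^ k,
      (pow_sum_smul_regVar_mem hmn t k).1.continuous⟩, pow_sum_smul_regVar_mem hmn t k⟩
  let τ (ε : Fin k → K) (j : Fin m) : K := ∑ i with w i = j, ε i
  have hτ (ε : Fin k → K) (x : RSpace m) :
      ∑ j, τ ε j • regVar K hmn j x = ∑ i, ε i • regVar K hmn (w i) x := by
    rw [← Finset.sum_fiberwise Finset.univ w]
    refine Finset.sum_congr rfl fun j _ => ?_
    rw [Finset.sum_smul]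
    refine Finset.sum_congr rfl fun i hi => ?_
    rw [(Finset.mem_filter.1 hi).2]
  refine ⟨((k ! : K)⁻¹ * ((2 : K) ^ k)⁻¹) •
    ∑ ε ∈ Fintype.piFinset fun _ : Fin k => ({1, -1} : Finset K), (∏ i, ε i) • pw (τ ε),
    fun x => ?_⟩
  have h := sum_perm_prod_eq_sum_pow K fun i => regVar K hmn (w i) x
  rw [symProd, ← inv_smul_smul₀ (pow_ne_zero k (two_ne_zero (α := K)))
    (∑ σ : Equiv.Perm (Fin k), (List.ofFn fun i => regVar K hmn (w (σ i)) x).prod), h, smul_smul]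
  simp only [← hτ]
  simp [pw]

end RegularProducts

/-! ### Cauchy estimates and Taylor's formula -/

section Derivatives

open Metric Set Filter Topology

variable {K : Type*} [RCLike K] {m n : ℕ} (hmn : m ≤ n)

theorem hyperholomorphic_contDiff (f : hyperholomorphic K hmn) (k : ℕ∞) : ContDiff ℝ k f.1 :=
  contDiff_of_dirac_eq_zero hmn f.2.1 f.2.2 k

theorem hyperholomorphic_differentiable (f : hyperholomorphic K hmn) : Differentiable ℝ f.1 :=
  f.2.1.differentiable (by simp)

/-- The directional derivative as an operator on the space of hyperholomorphic functions. -/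
noncomputable def dirDeriv (v : RSpace m) :
    Module.End K (hyperholomorphic K hmn) where
  toFun f := ⟨⟨fun x => fderiv ℝ f.1 x v,
      (f.2.1.continuous_fderiv (by simp)).clm_apply continuous_const⟩,
    ((hyperholomorphic_contDiff hmn f 2).fderiv_right (m := 1) (by norm_num)).clm_apply
      contDiff_const, dirac_fderiv_apply hmn f.2.1 f.2.2 v⟩
  map_add' f g := by
    ext x
    have h : fderiv ℝ (⇑f.1 + ⇑g.1) x = fderiv ℝ f.1 x + fderiv ℝ g.1 x :=
      fderiv_add (hyperholomorphic_differentiable hmn f x)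
        (hyperholomorphic_differentiable hmn g x)
    exact DFunLike.congr_fun h v
  map_smul' r f := by
    ext x
    have h : fderiv ℝ (r • ⇑f.1) x = r • fderiv ℝ f.1 x :=
      fderiv_const_smul (hyperholomorphic_differentiable hmn f x) r
    exact DFunLike.congr_fun h v

theorem dirDeriv_apply (v : RSpace m) (f : hyperholomorphic K hmn) (x : RSpace m) :
    (dirDeriv hmn v f).1 x = fderiv ℝ f.1 x v := rfl

theorem commute_dirDeriv (u v : RSpace m) :
    Commute (dirDeriv (K := K) hmn u) (dirDeriv hmn v) := by
  refine LinearMap.ext fun f => Subtype.ext (ContinuousMap.ext fun x => ?_)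
  have hf2 : ContDiff ℝ 2 f.1 := hyperholomorphic_contDiff hmn f 2
  have hd : DifferentiableAt ℝ (fderiv ℝ f.1) x :=
    (hf2.fderiv_right (m := 1) (by norm_num)).differentiable (by simp) x
  have hv (u w : RSpace m) : fderiv ℝ (fun x => fderiv ℝ f.1 x u) x w
      = fderiv ℝ (fderiv ℝ f.1) x w u := by
    rw [fderiv_clm_apply hd (differentiableAt_const u)]
    simp
  change fderiv ℝ (fun x => fderiv ℝ f.1 x v) x u = fderiv ℝ (fun x => fderiv ℝ f.1 x u) x v
  rw [hv, hv]
  exact (hf2.contDiffAt.isSymmSndFDerivAt (by simp)) u v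

/-- On hyperholomorphic functions the derivative in the direction `x` is `-∑ⱼ (eⱼ x₀ - xⱼ) ∂ⱼ`,
since `∂₀ = -∑ⱼ eⱼ ∂ⱼ`. -/
theorem dirDeriv_apply_eq_neg_sum (x : RSpace m) (f : hyperholomorphic K hmn) (y : RSpace m) :
    (dirDeriv hmn x f).1 y
      = -∑ j : Fin m, regVar K hmn j x *
        (dirDeriv hmn (EuclideanSpace.single j.succ 1) f).1 y := by
  have h0 := f.2.2 y
  rw [dirac, add_eq_zero_iff_eq_neg] at h0
  simp only [dirDeriv_apply]
  rw [fderiv_apply_eq_sum (fderiv ℝ f.1 y) x, Fin.sum_univ_succ, h0]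
  simp only [regVar, sub_mul, smul_mul_assoc, one_mul, Finset.sum_sub_distrib, smul_neg,
    Finset.smul_sum]
  abel

/-- The iterated partial derivative along a word in the letters `1, …, m`. -/
noncomputable def wordDeriv {k : ℕ} (w : Fin k → Fin m) :
    Module.End K (hyperholomorphic K hmn) :=
  (List.ofFn fun i => dirDeriv hmn (EuclideanSpace.single (w i).succ 1)).prod

theorem wordDeriv_comp_perm {k : ℕ} (w : Fin k → Fin m) (σ : Equiv.Perm (Fin k)) :
    wordDeriv (K := K) hmn (w ∘ σ) = wordDeriv hmn w := by
  refine List.Perm.prod_eq' (Equiv.Perm.ofFn_comp_perm σ fun i =>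
    dirDeriv hmn (EuclideanSpace.single (w i).succ 1)) ?_
  rw [List.pairwise_ofFn]
  intro i j _
  exact commute_dirDeriv hmn _ _

theorem wordDeriv_eq_of_wordContent_eq {k : ℕ} {w w' : Fin k → Fin m}
    (h : wordContent w = wordContent w') : wordDeriv (K := K) hmn w = wordDeriv hmn w' := by
  obtain ⟨σ, rfl⟩ := exists_perm_of_wordContent_eq h
  exact wordDeriv_comp_perm hmn w' σ

theorem commute_dirDeriv_wordDeriv (v : RSpace m) {k : ℕ} (w : Fin k → Fin m) :
    Commute (dirDeriv (K := K) hmn v) (wordDeriv hmn w) :=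
  Commute.list_prod_right _ _ fun x hx => by
    obtain ⟨i, rfl⟩ := List.mem_ofFn.1 hx
    exact commute_dirDeriv hmn _ _

theorem prod_ofFn_snoc {M ι : Type*} [Monoid M] (g : ι → M) {k : ℕ} (w : Fin k → ι) (j : ι) :
    (List.ofFn fun i => g ((Fin.snoc w j : Fin (k + 1) → ι) i)).prod
      = (List.ofFn fun i => g (w i)).prod * g j := by
  rw [List.ofFn_succ', List.concat_eq_append, List.prod_append]
  simp

theorem wordDeriv_snoc {k : ℕ} (w : Fin k → Fin m) (j : Fin m) :
    wordDeriv (K := K) hmn (Fin.snoc w j : Fin (k + 1) → Fin m)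
      = wordDeriv hmn w * dirDeriv hmn (EuclideanSpace.single j.succ 1) := by
  exact prod_ofFn_snoc (fun j : Fin m => dirDeriv hmn (EuclideanSpace.single j.succ 1)) w j

/-- The iterated directional derivatives of a hyperholomorphic function in the direction `x`,
expressed through the regular variables at `x` and the partial derivatives `∂₁, …, ∂ₘ`. -/
theorem dirDeriv_pow_apply (x : RSpace m) (k : ℕ) (f : hyperholomorphic K hmn) (y : RSpace m) :
    ((dirDeriv hmn x ^ k) f).1 y = (-1 : ℝ) ^ k • ∑ w : Fin k → Fin m,
      (List.ofFn fun i => regVar K hmn (w i) x).prod * (wordDeriv hmn w f).1 y := by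
  induction k generalizing f with
  | zero => simp [wordDeriv]
  | succ k ih =>
    rw [pow_succ, Module.End.mul_apply, ih, ← (Fin.snocEquiv fun _ => Fin m).sum_comp,
      Fintype.sum_prod_type, Finset.sum_comm, pow_succ, mul_smul, neg_one_smul,
      ← Finset.sum_neg_distrib]
    congr 1
    refine Finset.sum_congr rfl fun w _ => ?_
    rw [← Module.End.mul_apply, ← (commute_dirDeriv_wordDeriv hmn x w).eq, Module.End.mul_apply,
      dirDeriv_apply_eq_neg_sum, mul_neg, Finset.mul_sum]
    congr 1
    refine Finset.sum_congr rfl fun j _ => ?_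
    rw [← mul_assoc, ← Module.End.mul_apply, (commute_dirDeriv_wordDeriv hmn _ w).eq]
    simp only [Fin.snocEquiv, Equiv.coe_fn_mk, wordDeriv_snoc, Module.End.mul_apply]
    rw [prod_ofFn_snoc fun j => regVar K hmn j x]

/-- The Cauchy estimates, in the form that iterating the gradient estimate gives. -/
theorem exists_norm_list_prod_dirDeriv_le (m : ℕ) : ∃ C : ℝ, 0 < C ∧
    ∀ {K : Type*} [RCLike K] {n : ℕ} (hmn : m ≤ n) (l : List (RSpace m)) {V : ℝ},
      (∀ v ∈ l, ‖v‖ ≤ V) → ∀ {r M : ℝ}, 0 < r → ∀ (f : hyperholomorphic K hmn) (y : RSpace m),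
      (∀ z ∈ closedBall y (l.length * r), ‖f.1 z‖ ≤ M) →
      ‖((l.map (dirDeriv hmn)).prod f).1 y‖ ≤ (C * V / r) ^ l.length * M := by
  obtain ⟨C, hC, hgrad⟩ := exists_norm_fderiv_apply_le m
  refine ⟨C, hC, fun {K} _ {n} hmn l {V} hl {r M} hr f => ?_⟩
  induction l with
  | nil =>
    intro y hM
    simpa using hM y (by simp)
  | cons v l ih =>
    intro y hM
    have hv : ‖v‖ ≤ V := hl v (by simp)
    have hV : 0 ≤ V := (norm_nonneg v).trans hv
    rw [List.map_cons, List.prod_cons, Module.End.mul_apply, dirDeriv_apply]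
    have h1 := hgrad hmn ((l.map (dirDeriv hmn)).prod f).2.1 ((l.map (dirDeriv hmn)).prod f).2.2
      y v hr (M := (C * V / r) ^ l.length * M) fun z hz =>
        ih (fun u hu => hl u (by simp [hu])) z fun u hu => hM u (by
          simp only [mem_closedBall, List.length_cons, Nat.cast_add, Nat.cast_one] at hu hz ⊢
          linarith [dist_triangle u z y])
    have hM0 : 0 ≤ M := (norm_nonneg _).trans (hM y (mem_closedBall_self (by positivity)))
    refine h1.trans ?_
    rw [List.length_cons, pow_succ', mul_assoc]
    gcongr

/-- The Cauchy estimates for the Taylor coefficients. -/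
theorem exists_norm_list_prod_dirDeriv_div_factorial_le (m : ℕ) : ∃ C : ℝ, 0 < C ∧
    ∀ {K : Type*} [RCLike K] {n : ℕ} (hmn : m ≤ n) (l : List (RSpace m)) {V : ℝ},
      (∀ v ∈ l, ‖v‖ ≤ V) → ∀ {R M : ℝ}, 0 < R → ∀ (f : hyperholomorphic K hmn) (y : RSpace m),
      (∀ z ∈ closedBall y R, ‖f.1 z‖ ≤ M) →
      ‖((l.map (dirDeriv hmn)).prod f).1 y‖ / (l.length)! ≤ (C * V / R) ^ l.length * M := by
  obtain ⟨C, hC, hprod⟩ := exists_norm_list_prod_dirDeriv_le m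
  refine ⟨C * Real.exp 1, by positivity, fun {K} _ {n} hmn l {V} hl {R M} hR f y hM => ?_⟩
  -- Reach radius `R` in `k` steps of length `R / k`, and use `kᵏ / k! ≤ eᵏ`.
  rcases l with - | ⟨v, l⟩
  · simpa using hM y (mem_closedBall_self hR.le)
  generalize hl' : v :: l = l' at *
  have hk : 0 < (l'.length : ℝ) := by simp [← hl']; positivity
  have hV : 0 ≤ V := (norm_nonneg v).trans (hl v (by simp [← hl']))
  have hM0 : 0 ≤ M := (norm_nonneg _).trans (hM y (mem_closedBall_self hR.le))
  set k := l'.length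
  have h1 := hprod hmn l' hl (r := R / k) (by positivity) f y (M := M) (by
    rwa [mul_div_cancel₀ _ hk.ne'])
  have h2 : (k : ℝ) ^ k / k ! ≤ Real.exp 1 ^ k := by
    rw [← Real.exp_nat_mul, mul_one]
    exact Real.pow_div_factorial_le_exp _ hk.le k
  calc ‖((l'.map (dirDeriv hmn)).prod f).1 y‖ / k ! ≤ (C * V / (R / k)) ^ k * M / k ! := by gcongr
    _ = (C * V / R) ^ k * ((k : ℝ) ^ k / k !) * M := by
      rw [show C * V / (R / k) = C * V / R * k by field_simp, mul_pow]
      ring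
    _ ≤ (C * V / R) ^ k * Real.exp 1 ^ k * M := by gcongr
    _ = (C * Real.exp 1 * V / R) ^ k * M := by
      rw [← mul_pow]
      ring

/-- Taylor's formula along the segment from `0` to `x`. -/
theorem norm_sub_taylor_le (x : RSpace m) (k : ℕ) (f : hyperholomorphic K hmn) {M : ℝ}
    (hM : ∀ s ∈ Icc (0 : ℝ) 1, ‖((dirDeriv hmn x ^ k) f).1 (s • x)‖ ≤ M) :
    ∀ t ∈ Icc (0 : ℝ) 1,
      ‖f.1 (t • x) - ∑ i ∈ Finset.range k, (t ^ i / i !) • ((dirDeriv hmn x ^ i) f).1 0‖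
        ≤ M * (t ^ k / k !) := by
  induction k generalizing f with
  | zero => simpa using hM
  | succ k ih =>
    have hIH := ih (dirDeriv hmn x f) (by simpa only [pow_succ, Module.End.mul_apply] using hM)
    have hpow (i : ℕ) (t : ℝ) :
        HasDerivAt (fun t : ℝ => t ^ (i + 1) / (i + 1)!) (t ^ i / i !) t := by
      refine ((hasDerivAt_pow (i + 1) t).div_const _).congr_deriv ?_
      rw [Nat.factorial_succ]
      push_cast
      have : (i ! : ℝ) ≠ 0 := Nat.cast_ne_zero.2 (Nat.factorial_ne_zero i)
      field_simp
    have hderiv (t : ℝ) : HasDerivAt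
        (fun t : ℝ => f.1 (t • x) -
          ∑ i ∈ Finset.range (k + 1), (t ^ i / i !) • ((dirDeriv hmn x ^ i) f).1 0)
        ((dirDeriv hmn x f).1 (t • x) -
          ∑ i ∈ Finset.range k, (t ^ i / i !) • ((dirDeriv hmn x ^ i) (dirDeriv hmn x f)).1 0)
        t := by
      have h1 : HasDerivAt (fun t : ℝ => f.1 (t • x)) (fderiv ℝ f.1 (t • x) x) t := by
        have h2 : HasDerivAt (fun t : ℝ => t • x) x t := by
          simpa using (hasDerivAt_id t).smul_const x
        exact (hyperholomorphic_differentiable hmn f (t • x)).hasFDerivAt.comp_hasDerivAt t h2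
      refine h1.sub ?_
      simp only [Finset.sum_range_succ', pow_zero]
      refine HasDerivAt.add_const _ (HasDerivAt.fun_sum fun i _ => ?_)
      rw [pow_succ (dirDeriv hmn x), Module.End.mul_apply]
      exact (hpow i t).smul_const _
    refine image_norm_le_of_norm_deriv_right_le_deriv_boundary
      (B := fun t => M * (t ^ (k + 1) / (k + 1)!)) (B' := fun t => M * (t ^ k / k !))
      (fun t _ => (hderiv t).continuousAt.continuousWithinAt)
      (fun t _ => (hderiv t).hasDerivWithinAt) ?_ (fun t => (hpow k t).const_mul M)
      (fun t ht => hIH t ⟨ht.1, ht.2.le⟩)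
    simp [Finset.sum_range_succ']

/-- The Taylor series of an entire hyperholomorphic function converges to it. -/
theorem tendsto_taylor (f : hyperholomorphic K hmn) (x : RSpace m) :
    Tendsto (fun k => ∑ i ∈ Finset.range k, (i ! : ℝ)⁻¹ • ((dirDeriv hmn x ^ i) f).1 0) atTop
      (𝓝 (f.1 x)) := by
  obtain ⟨C, hC, hcauchy⟩ := exists_norm_list_prod_dirDeriv_div_factorial_le m
  -- With this radius the remainder after `k` terms is at most `2⁻ᵏ sup |f|`.
  set R : ℝ := 2 * C * (‖x‖ + 1) with hR
  have hR0 : 0 < R := by positivity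
  obtain ⟨M, hM⟩ := (isCompact_closedBall (0 : RSpace m) (‖x‖ + R)).exists_bound_of_continuousOn
    f.1.continuous.continuousOn
  have hbound (k : ℕ) :
      ‖f.1 x - ∑ i ∈ Finset.range k, (i ! : ℝ)⁻¹ • ((dirDeriv hmn x ^ i) f).1 0‖
        ≤ (1 / 2) ^ k * M := by
    have h1 (s : ℝ) (hs : s ∈ Icc (0 : ℝ) 1) :
        ‖((dirDeriv hmn x ^ k) f).1 (s • x)‖ ≤ (1 / 2) ^ k * M * k ! := by
      have h2 := hcauchy hmn (List.replicate k x) (V := ‖x‖ + 1) (by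
        intro v hv
        rw [List.eq_of_mem_replicate hv]
        linarith) hR0 f (s • x) (M := M) fun z hz => hM z (by
          rw [mem_closedBall, dist_eq_norm] at *
          have h3 : ‖s • x‖ ≤ ‖x‖ := by
            rw [norm_smul, Real.norm_of_nonneg hs.1]
            exact mul_le_of_le_one_left (norm_nonneg x) hs.2
          have h4 : ‖z‖ ≤ ‖z - s • x‖ + ‖s • x‖ := by simpa using norm_add_le (z - s • x) (s • x)
          rw [sub_zero]
          linarith)
      rw [List.map_replicate, List.prod_replicate, List.length_replicate,
        div_le_iff₀ (by positivity)] at h2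
      rwa [hR, show C * (‖x‖ + 1) / (2 * C * (‖x‖ + 1)) = 1 / 2 by field_simp] at h2
    have h5 := norm_sub_taylor_le hmn x k f h1 1 (by simp)
    simp only [one_smul, one_pow, one_div] at h5
    refine h5.trans (le_of_eq ?_)
    field_simp
  rw [tendsto_iff_norm_sub_tendsto_zero]
  refine squeeze_zero (fun _ => norm_nonneg _) (fun k => ?_)
    ((tendsto_pow_atTop_nhds_zero_of_lt_one (r := (1 / 2 : ℝ)) (by norm_num)
      (by norm_num)).mul_const M |>.trans_eq (by rw [zero_mul]))
  rw [norm_sub_rev]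
  exact hbound k

end Derivatives

/-! ### Uniqueness of the coefficients -/

section PowerSeriesUniqueness

open Metric Set Filter Topology

/-- A real power series in several variables that converges unconditionally to `0` everywhere has
zero coefficients: restrict to lines through the origin, so that every homogeneous part vanishes. -/
theorem eq_zero_of_hasSum_prod_pow_mul {m : ℕ} {d : (Fin m → ℕ) → ℝ}
    (h : ∀ y : Fin m → ℝ, HasSum (fun α : Fin m → ℕ => (∏ j, y j ^ α j) * d α) 0) : d = 0 := by
  set P : ℕ → MvPolynomial (Fin m) ℝ := fun k =>
    ∑ α ∈ Finset.piAntidiag (Finset.univ : Finset (Fin m)) k,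
      MvPolynomial.monomial (Finsupp.equivFunOnFinite.symm α) (d α) with hP
  have heval (k : ℕ) (y : Fin m → ℝ) : MvPolynomial.eval y (P k)
      = ∑ α ∈ Finset.piAntidiag (Finset.univ : Finset (Fin m)) k, (∏ j, y j ^ α j) * d α := by
    simp only [hP, map_sum, MvPolynomial.eval_monomial]
    refine Finset.sum_congr rfl fun α _ => ?_
    rw [Finsupp.prod_fintype _ _ fun i => pow_zero _]
    simp [mul_comm]
  have hline (y : Fin m → ℝ) (t : ℝ) :
      HasSum (fun k => t ^ k • MvPolynomial.eval y (P k)) 0 := by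
    have h1 := (Equiv.sigmaFiberEquiv fun α : Fin m → ℕ => ∑ j, α j).hasSum_iff.2 (h (t • y))
    refine h1.sigma fun k => ?_
    have h2 : HasSum (fun α : {α // α ∈ Finset.piAntidiag (Finset.univ : Finset (Fin m)) k} =>
        (∏ j, (t • y) j ^ α.1 j) * d α.1) (t ^ k • MvPolynomial.eval y (P k)) := by
      rw [heval, Finset.smul_sum, ← Finset.sum_coe_sort]
      convert hasSum_fintype _ using 2 with α
      have h3 : ∑ j, α.1 j = k := (Finset.mem_piAntidiag.1 α.2).1
      simp only [Pi.smul_apply, smul_eq_mul, mul_pow, Finset.prod_mul_distrib,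
        Finset.prod_pow_eq_pow_sum, h3, mul_assoc]
    refine ((Equiv.subtypeEquivRight fun α => ?_).hasSum_iff).1 h2
    simp
  have hP0 (k : ℕ) : P k = 0 := by
    refine MvPolynomial.funext fun y => ?_
    set p : FormalMultilinearSeries ℝ ℝ ℝ := fun k =>
      ContinuousMultilinearMap.mkPiRing ℝ (Fin k) (MvPolynomial.eval y (P k)) with hp
    have hp0 : p = 0 := by
      refine HasFPowerSeriesAt.eq_zero (x := 0) (hasFPowerSeriesAt_iff.2 ?_)
      refine Eventually.of_forall fun t => ?_
      simpa [hp, FormalMultilinearSeries.coeff] using hline y t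
    have h4 : p.coeff k = 0 := by rw [hp0]; rfl
    simpa [hp, FormalMultilinearSeries.coeff] using h4
  funext α
  have h5 := congrArg (MvPolynomial.coeff (Finsupp.equivFunOnFinite.symm α)) (hP0 (∑ j, α j))
  simp only [hP, MvPolynomial.coeff_sum, MvPolynomial.coeff_monomial, EmbeddingLike.apply_eq_iff_eq,
    MvPolynomial.coeff_zero] at h5
  rw [Finset.sum_ite_eq' _ α, if_pos (by simp)] at h5
  exact h5

end PowerSeriesUniqueness

section FueterUniqueness

open Metric Set Filter Topology

variable {K : Type*} [RCLike K] {m n : ℕ} (hmn : m ≤ n)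

theorem symPow_eq_prod_pow {F : Type*} [Field F] [CharZero F] (r : Fin m → F) (α : Fin m → ℕ) :
    symPow F r α = ∏ j, r j ^ α j := by
  have h (σ : Equiv.Perm (Fin (indexList α).length)) :
      (List.ofFn fun i => r ((indexList α).get (σ i))).prod = ∏ j, r j ^ α j := by
    rw [List.prod_ofFn, Equiv.prod_comp σ fun i => r ((indexList α).get i),
      ← Finset.prod_fiberwise' Finset.univ (indexList α).get r]
    refine Finset.prod_congr rfl fun j _ => ?_
    rw [Finset.prod_const]
    congr 1
    conv_rhs => rw [← wordContent_get_indexList α]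
    rw [wordContent, Fintype.card_subtype]
  rw [symPow, symProd]
  simp only [h, Finset.sum_const, Finset.card_univ, Fintype.card_perm, Fintype.card_fin]
  rw [← Nat.cast_smul_eq_nsmul F, inv_smul_smul₀ (Nat.cast_ne_zero.2 (Nat.factorial_ne_zero _))]

/-- On the hyperplane `x₀ = 0` the symmetric polynomials are, up to sign, the real monomials. -/
theorem fueterPoly_of_apply_zero_eq_zero (α : Fin m → ℕ) (x : RSpace m) (hx : x 0 = 0) :
    fueterPoly K hmn α x = (∏ j, (-x j.succ) ^ α j) • 1 := by
  have h1 (j : Fin m) : regVar K hmn j x = algebraMap K (Cl K n) (-(x j.succ : ℝ) : K) := by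
    rw [regVar, hx, zero_smul, zero_sub, map_neg, Algebra.algebraMap_eq_smul_one,
      ← algebraMap_smul K (x j.succ) (1 : Cl K n)]
  rw [fueterPoly, symPow]
  simp only [h1]
  rw [← map_symProd (F := K) (F' := K) (algebraMap K (Cl K n))
    (fun r => by rw [smul_eq_mul, map_mul, Algebra.smul_def])
    fun i => (-(x ((indexList α).get i).succ : ℝ) : K)]
  rw [show symProd K (fun i => (-(x ((indexList α).get i).succ : ℝ) : K))
    = symPow K (fun j => (-(x j.succ : ℝ) : K)) α from rfl, symPow_eq_prod_pow,
    Algebra.algebraMap_eq_smul_one, ← algebraMap_smul K (∏ j, (-x j.succ) ^ α j) (1 : Cl K n)]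
  simp

/-- The coefficients of a Fueter series are determined by its sum. -/
theorem eq_of_hasSum_fueterPoly {c c' : (Fin m → ℕ) → Cl K n} {f : RSpace m → Cl K n}
    (hc : ∀ x, HasSum (fun α => fueterPoly K hmn α x * c α) (f x))
    (hc' : ∀ x, HasSum (fun α => fueterPoly K hmn α x * c' α) (f x)) : c' = c := by
  -- Apply a real functional and restrict to `x₀ = 0`, where the series is a real power series.
  rw [← sub_eq_zero]
  funext α
  rw [Pi.zero_apply, ← Module.forall_dual_apply_eq_zero_iff ℝ]
  intro l
  suffices h : (fun α => l ((c' - c) α)) = 0 from congrFun h α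
  refine eq_zero_of_hasSum_prod_pow_mul fun y => ?_
  set x : RSpace m := WithLp.toLp 2 (Fin.cons 0 fun j => -y j) with hx
  have h1 := ((hc' x).sub (hc x)).mapL (LinearMap.toContinuousLinearMap l)
  rw [sub_self, map_zero] at h1
  refine h1.congr_fun fun α => ?_
  rw [← mul_sub, fueterPoly_of_apply_zero_eq_zero hmn α x (by simp [hx])]
  simp [hx]

end FueterUniqueness

/-! ### The Fueter series -/

section WordSums

open Metric Set Filter Topology

variable {m : ℕ}

/-- Regrouping a series over the words in `1, …, m` by content. -/
theorem HasSum.sum_wordsOfContent {E : Type*} [AddCommMonoid E] [TopologicalSpace E]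
    [ContinuousAdd E] [RegularSpace E] {g : (Σ k : ℕ, (Fin k → Fin m)) → E} {s : E}
    (hg : HasSum g s) :
    HasSum (fun α => ∑ w : WordsOfContent α, g ⟨(indexList α).length, w.1⟩) s := by
  have h := (Equiv.sigmaFiberEquiv
    fun p : Σ k : ℕ, (Fin k → Fin m) => wordContent p.2).hasSum_iff.2 hg
  refine h.sigma fun α => ?_
  let e : WordsOfContent α → {p : Σ k : ℕ, (Fin k → Fin m) // wordContent p.2 = α} :=
    fun w => ⟨⟨_, w.1⟩, w.2⟩
  have he : Function.Bijective e := by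
    constructor
    · intro w w' hw
      have := congrArg Subtype.val hw
      simp only [e, Sigma.mk.injEq, heq_eq_eq, true_and] at this
      exact Subtype.ext this
    · rintro ⟨⟨k, w⟩, hw⟩
      obtain rfl : k = (indexList α).length := by
        rw [length_indexList, ← hw, sum_wordContent]
      exact ⟨⟨w, hw⟩, rfl⟩
  exact (Equiv.ofBijective e he).hasSum_iff.1 (hasSum_fintype _)

theorem summable_word_pow (m : ℕ) :
    Summable fun p : Σ k : ℕ, (Fin k → Fin m) => ((m + 1 : ℝ)⁻¹) ^ p.1 := by
  rw [summable_sigma_of_nonneg fun p => by positivity]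
  refine ⟨fun k => Summable.of_finite, ?_⟩
  have h1 (k : ℕ) : ∑' _ : Fin k → Fin m, ((m + 1 : ℝ)⁻¹) ^ k = ((m : ℝ) * (m + 1 : ℝ)⁻¹) ^ k := by
    rw [tsum_fintype]
    simp [mul_pow]
  simp only [h1]
  refine summable_geometric_of_lt_one (by positivity) ?_
  rw [← div_eq_mul_inv, div_lt_one (by positivity)]
  linarith

end WordSums

section FueterSeries

open Metric Set Filter Topology

variable {K : Type*} [RCLike K] {m n : ℕ} (hmn : m ≤ n)

/-- The Taylor coefficient `(-1)ᵏ ∂_w f(0) / k!` attached to a word `w` of length `k`. -/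
noncomputable def wordCoeff {k : ℕ} (w : Fin k → Fin m) (f : hyperholomorphic K hmn) : Cl K n :=
  ((-1 : K) ^ k / k !) • (wordDeriv hmn w f).1 0

/-- The coefficients of an entire hyperholomorphic function decay faster than any geometric
sequence. -/
theorem exists_pow_mul_norm_wordCoeff_le (m : ℕ) (B : ℝ) (hB : 0 < B) : ∃ R : ℝ, 0 < R ∧
    ∀ {K : Type*} [RCLike K] {n : ℕ} (hmn : m ≤ n) (f : hyperholomorphic K hmn) {M : ℝ},
      (∀ z ∈ closedBall (0 : RSpace m) R, ‖f.1 z‖ ≤ M) →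
      ∀ {k : ℕ} (w : Fin k → Fin m),
        B ^ k * ‖wordCoeff hmn w f‖ ≤ ((m + 1 : ℝ)⁻¹) ^ k * M := by
  obtain ⟨C, hC, hcauchy⟩ := exists_norm_list_prod_dirDeriv_div_factorial_le m
  -- `B` is absorbed by the radius, and `m + 1` makes up for the `mᵏ` words of length `k`.
  refine ⟨C * B * (m + 1), by positivity, fun {K} _ {n} hmn f {M} hM {k} w => ?_⟩
  have h := hcauchy hmn (List.ofFn fun i => EuclideanSpace.single (w i).succ (1 : ℝ)) (V := 1)
    (by
      intro v hv
      obtain ⟨i, rfl⟩ := List.mem_ofFn.1 hv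
      simp) (by positivity) f 0 hM
  rw [List.map_ofFn, List.length_ofFn, mul_one] at h
  change ‖(wordDeriv hmn w f).1 0‖ / k ! ≤ _ at h
  have h1 : ‖wordCoeff hmn w f‖ = ‖(wordDeriv hmn w f).1 0‖ / k ! := by
    rw [wordCoeff, norm_smul]
    simp [div_eq_inv_mul]
  rw [h1]
  calc B ^ k * (‖(wordDeriv hmn w f).1 0‖ / k !)
      ≤ B ^ k * ((C / (C * B * (m + 1))) ^ k * M) := by gcongr
    _ = ((m + 1 : ℝ)⁻¹) ^ k * M := by
      rw [← mul_assoc, ← mul_pow]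
      congr 2
      field_simp

/-- The product of the regular variables along the word `w`, times the Taylor coefficient. -/
noncomputable def wordTerm (f : hyperholomorphic K hmn) (p : Σ k : ℕ, (Fin k → Fin m)) :
    C(RSpace m, Cl K n) where
  toFun x := (List.ofFn fun i => regVar K hmn (p.2 i) x).prod * wordCoeff hmn p.2 f
  continuous_toFun := by
    simp only [List.ofFn_eq_map]
    exact (continuous_list_prod (M := Cl K n) _ fun i _ => continuous_regVar K hmn _).mul
      continuous_const

theorem norm_list_prod_mul_le {A B : ℝ} (hA : ∀ a b : Cl K n, ‖a * b‖ ≤ A * ‖a‖ * ‖b‖)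
    (hA0 : 0 ≤ A) (l : List (Cl K n)) (hl : ∀ a ∈ l, ‖a‖ ≤ B) (b : Cl K n) :
    ‖l.prod * b‖ ≤ (A * B) ^ l.length * ‖b‖ := by
  induction l with
  | nil => simp
  | cons a l ih =>
    have ha : ‖a‖ ≤ B := hl a (by simp)
    have hB : 0 ≤ B := (norm_nonneg a).trans ha
    rw [List.prod_cons, mul_assoc, List.length_cons, pow_succ', mul_assoc]
    refine (hA _ _).trans ?_
    gcongr
    exact ih fun a ha => hl a (by simp [ha])

theorem summable_wordTerm (f : hyperholomorphic K hmn) : Summable (wordTerm hmn f) := by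
  refine ContinuousMap.summable_of_locally_summable_norm fun S => ?_
  obtain ⟨A, hA1, hA⟩ := Cl.exists_norm_mul_le K n
  obtain ⟨B, hB0, hB⟩ : ∃ B : ℝ, 0 < B ∧ ∀ (j : Fin m), ∀ x ∈ (S : Set (RSpace m)),
      ‖regVar K hmn j x‖ ≤ B := by
    choose b hb using fun j : Fin m => S.isCompact.exists_bound_of_continuousOn
      (continuous_regVar K hmn j).continuousOn
    refine ⟨∑ j, |b j| + 1, by positivity, fun j x hx => (hb j x hx).trans ?_⟩
    have := Finset.single_le_sum (f := fun j => |b j|) (fun i _ => abs_nonneg _)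
      (Finset.mem_univ j)
    linarith [le_abs_self (b j)]
  obtain ⟨R, hR, hcoeff⟩ := exists_pow_mul_norm_wordCoeff_le m (A * B) (by positivity)
  obtain ⟨M, hM⟩ := (isCompact_closedBall (0 : RSpace m) R).exists_bound_of_continuousOn
    f.1.continuous.continuousOn
  have hM0 : 0 ≤ M := (norm_nonneg _).trans (hM 0 (mem_closedBall_self hR.le))
  refine Summable.of_nonneg_of_le (fun _ => norm_nonneg _) (fun p => ?_)
    ((summable_word_pow m).mul_right M)
  rw [ContinuousMap.norm_le _ (by positivity)]
  intro x
  refine le_trans ?_ (hcoeff hmn f hM p.2)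
  have h := norm_list_prod_mul_le hA (by linarith) (B := B)
    (List.ofFn fun i => regVar K hmn (p.2 i) x.1) (by
      intro a ha
      obtain ⟨i, rfl⟩ := List.mem_ofFn.1 ha
      exact hB _ _ x.2) (wordCoeff hmn p.2 f)
  rwa [List.length_ofFn] at h

/-- The noncommutative Taylor expansion of an entire hyperholomorphic function in the regular
variables. -/
theorem hasSum_wordTerm (f : hyperholomorphic K hmn) : HasSum (wordTerm hmn f) f.1 := by
  have hs := (summable_wordTerm hmn f).hasSum
  convert hs
  ext1 x
  have h1 : HasSum (fun p => wordTerm hmn f p x) ((∑' p, wordTerm hmn f p) x) :=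
    ContinuousMap.hasSum_apply hs x
  have h2 : HasSum (fun k => ∑ w : Fin k → Fin m, wordTerm hmn f ⟨k, w⟩ x)
      ((∑' p, wordTerm hmn f p) x) := h1.sigma fun k => hasSum_fintype _
  refine tendsto_nhds_unique (tendsto_taylor hmn f x) ?_
  convert h2.tendsto_sum_nat using 4 with k i
  rw [dirDeriv_pow_apply, smul_smul, Finset.smul_sum]
  refine Finset.sum_congr rfl fun w _ => ?_
  simp only [wordTerm, wordCoeff, ContinuousMap.coe_mk, mul_smul_comm]
  rw [← algebraMap_smul K ((i ! : ℝ)⁻¹ * (-1) ^ i)]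
  congr 1
  simp [div_eq_inv_mul]

/-- The coefficient of `V_α` in the Fueter series of `f`. Since `symPow` is the mean over the words
of content `α`, their number `|α|! / α!` appears as a factor, and the value is
`(-1)^|α| ∂^α f(0) / α!`. -/
noncomputable def fueterCoeff (f : hyperholomorphic K hmn) (α : Fin m → ℕ) : Cl K n :=
  (Fintype.card (WordsOfContent α) : K) • wordCoeff hmn (indexList α).get f

theorem wordCoeff_eq_of_wordsOfContent (f : hyperholomorphic K hmn) {α : Fin m → ℕ}
    (w : WordsOfContent α) : wordCoeff hmn w.1 f = wordCoeff hmn (indexList α).get f := by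
  rw [wordCoeff, wordCoeff, wordDeriv_eq_of_wordContent_eq hmn
    (w.2.trans (wordContent_get_indexList α).symm)]

theorem hasSum_fueterTerm (f : hyperholomorphic K hmn) :
    HasSum (fun α => fueterTerm K hmn α (fueterCoeff hmn f α)) f.1 := by
  convert (hasSum_wordTerm hmn f).sum_wordsOfContent using 2 with α
  ext1 x
  simp only [ContinuousMap.coe_sum, Finset.sum_apply, fueterTerm, wordTerm, ContinuousMap.coe_mk,
    fueterCoeff, wordCoeff_eq_of_wordsOfContent, ← Finset.sum_mul]
  rw [sum_wordsOfContent_prod K fun j => regVar K hmn j x, mul_smul_comm, smul_mul_assoc]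
  rfl

theorem hasSum_fueterPoly (f : hyperholomorphic K hmn) (x : RSpace m) :
    HasSum (fun α => fueterPoly K hmn α x * fueterCoeff hmn f α) (f.1 x) :=
  ContinuousMap.hasSum_apply (hasSum_fueterTerm hmn f) x

end FueterSeries

/-! ### The functional calculus -/

section Calculus

open Metric Set Filter Topology

variable {K 𝕜 : Type*} [RCLike K] [RCLike 𝕜] [NormedAlgebra K 𝕜] {m n : ℕ} (hmn : m ≤ n)
  {H : Type*} [NormedAddCommGroup H] [InnerProductSpace 𝕜 H]
  {H₀ : Type*} [NormedAddCommGroup H₀] [InnerProductSpace 𝕜 H₀]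
  (T : Fin m → H →L[𝕜] H) {ρ : Cl K n →+* (H₀ →L[𝕜] H₀)}

theorem rep_smul (hρ : ∀ r : K, ρ (algebraMap K (Cl K n) r) = algebraMap K 𝕜 r • (1 : H₀ →L[𝕜] H₀))
    (r : K) (c : Cl K n) : ρ (r • c) = algebraMap K 𝕜 r • ρ c := by
  rw [Algebra.smul_def, map_mul, hρ, smul_mul_assoc, one_mul]

/-- The operator `S ↦ S ⊗ B` as a continuous linear map. -/
noncomputable def mapLRight (B : H₀ →L[𝕜] H₀) :
    (H →L[𝕜] H) →L[𝕜] (H ⊗[𝕜] H₀ →L[𝕜] H ⊗[𝕜] H₀) :=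
  LinearMap.mkContinuous
    { toFun := fun S => TensorProduct.mapL S B
      map_add' := fun S S' => TensorProduct.mapL_add_left S S' B
      map_smul' := fun r S => TensorProduct.mapL_smul_left r S B } ‖B‖ fun S => by
    rw [mul_comm]
    exact TensorProduct.norm_mapL_le S B

@[simp]
theorem mapLRight_apply (B : H₀ →L[𝕜] H₀) (S : H →L[𝕜] H) :
    mapLRight B S = TensorProduct.mapL S B := rfl

theorem mapL_sum_right {ι : Type*} (s : Finset ι) (S : H →L[𝕜] H) (B : ι → H₀ →L[𝕜] H₀) :
    TensorProduct.mapL S (∑ i ∈ s, B i) = ∑ i ∈ s, TensorProduct.mapL S (B i) := by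
  classical
  induction s using Finset.induction_on with
  | empty => simp
  | insert i s hi ih =>
    rw [Finset.sum_insert hi, Finset.sum_insert hi, TensorProduct.mapL_add_right, ih]

theorem exists_norm_le_of_fin {E : Type*} [SeminormedAddCommGroup E] (T : Fin m → E) :
    ∃ B : ℝ, 0 < B ∧ ∀ j, ‖T j‖ ≤ B :=
  ⟨∑ j, ‖T j‖ + 1, by positivity, fun j => by
    linarith [Finset.single_le_sum (f := fun j => ‖T j‖) (fun i _ => norm_nonneg _)
      (Finset.mem_univ j)]⟩

theorem norm_prod_ofFn_le {B : ℝ} (hB : ∀ j, ‖T j‖ ≤ B) {k : ℕ} (w : Fin k → Fin m) :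
    ‖(List.ofFn fun i => T (w i)).prod‖ ≤ B ^ k := by
  induction k with
  | zero =>
    rw [List.ofFn_zero, List.prod_nil, pow_zero]
    exact ContinuousLinearMap.norm_id_le
  | succ k ih =>
    rw [List.ofFn_succ, List.prod_cons, pow_succ']
    exact (norm_mul_le _ _).trans
      (mul_le_mul (hB _) (ih _) (norm_nonneg _) ((norm_nonneg _).trans (hB (w 0))))

/-- The term of the operator series that belongs to a word. -/
noncomputable def opTerm (ρ : Cl K n →+* (H₀ →L[𝕜] H₀)) (f : hyperholomorphic K hmn)
    (p : Σ k : ℕ, (Fin k → Fin m)) : H ⊗[𝕜] H₀ →L[𝕜] H ⊗[𝕜] H₀ :=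
  TensorProduct.mapL (List.ofFn fun i => T (p.2 i)).prod (ρ (wordCoeff hmn p.2 f))

theorem norm_coords_apply_le (c : Cl K n) (A : Finset (Fin n)) : ‖Cl.coords K n c A‖ ≤ ‖c‖ :=
  PiLp.norm_apply_le (Cl.coords K n c) A

theorem rep_eq_sum
    (hρ : ∀ r : K, ρ (algebraMap K (Cl K n) r) = algebraMap K 𝕜 r • (1 : H₀ →L[𝕜] H₀))
    (c : Cl K n) :
    ρ c = ∑ A, algebraMap K 𝕜 (Cl.coords K n c A) • ρ (Cl.basis K n A) := by
  conv_lhs => rw [← (Cl.basis K n).sum_equivFun c]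
  rw [map_sum]
  exact Finset.sum_congr rfl fun A _ => rep_smul hρ _ _

/-- The operator series converges. Completeness of `H ⊗ H₀` is avoided: in a basis of the Clifford
algebra the series splits into finitely many series in the complete space `B(H)`. -/
theorem summable_opTerm [CompleteSpace H]
    (hρ : ∀ r : K, ρ (algebraMap K (Cl K n) r) = algebraMap K 𝕜 r • (1 : H₀ →L[𝕜] H₀))
    (f : hyperholomorphic K hmn) : Summable (opTerm hmn T ρ f) := by
  obtain ⟨B, hB0, hB⟩ := exists_norm_le_of_fin T
  obtain ⟨R, hR, hcoeff⟩ := exists_pow_mul_norm_wordCoeff_le m B hB0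
  obtain ⟨M, hM⟩ := (isCompact_closedBall (0 : RSpace m) R).exists_bound_of_continuousOn
    f.1.continuous.continuousOn
  have hA (A : Finset (Fin n)) : Summable fun p : Σ k : ℕ, (Fin k → Fin m) =>
      algebraMap K 𝕜 (Cl.coords K n (wordCoeff hmn p.2 f) A) •
        (List.ofFn fun i => T (p.2 i)).prod := by
    refine Summable.of_norm_bounded ((summable_word_pow m).mul_right M) fun p => ?_
    refine le_trans ?_ (hcoeff hmn f hM p.2)
    rw [norm_smul, norm_algebraMap', mul_comm]
    exact mul_le_mul (norm_prod_ofFn_le T hB _) (norm_coords_apply_le _ _) (norm_nonneg _)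
      (by positivity)
  have h := summable_sum fun A (_ : A ∈ Finset.univ) =>
    (hA A).mapL (mapLRight (H := H) (ρ (Cl.basis K n A)))
  refine h.congr fun p => ?_
  rw [opTerm, rep_eq_sum hρ, mapL_sum_right]
  refine Finset.sum_congr rfl fun A _ => ?_
  rw [mapLRight_apply, TensorProduct.mapL_smul_left, TensorProduct.mapL_smul_right]

/-- The operator series is controlled by the supremum of `f` on one fixed ball, which is the
continuity of the functional calculus. -/
theorem exists_norm_tsum_opTerm_le [CompleteSpace H]
    (hρ : ∀ r : K, ρ (algebraMap K (Cl K n) r) = algebraMap K 𝕜 r • (1 : H₀ →L[𝕜] H₀)) :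
    ∃ R C : ℝ, ∀ (f : hyperholomorphic K hmn) {M : ℝ},
      (∀ z ∈ closedBall (0 : RSpace m) R, ‖f.1 z‖ ≤ M) → ‖∑' p, opTerm hmn T ρ f p‖ ≤ C * M := by
  obtain ⟨B, hB0, hB⟩ := exists_norm_le_of_fin T
  obtain ⟨R, hR, hcoeff⟩ := exists_pow_mul_norm_wordCoeff_le m B hB0
  set D : ℝ := ∑ A, ‖ρ (Cl.basis K n A)‖ with hD
  have hD0 : 0 ≤ D := Finset.sum_nonneg fun _ _ => norm_nonneg _
  have hρn (c : Cl K n) : ‖ρ c‖ ≤ ‖c‖ * D := by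
    rw [rep_eq_sum hρ, hD, Finset.mul_sum]
    refine norm_sum_le_of_le _ fun A _ => ?_
    rw [norm_smul, norm_algebraMap']
    gcongr
    exact norm_coords_apply_le _ _
  refine ⟨R, D * ∑' p : Σ k : ℕ, (Fin k → Fin m), ((m + 1 : ℝ)⁻¹) ^ p.1, fun f M hM => ?_⟩
  refine ((summable_opTerm hmn T hρ f).hasSum.norm_le_of_bounded
    (((summable_word_pow m).hasSum.mul_left D).mul_right M)) fun p => ?_
  refine (TensorProduct.norm_mapL_le _ _).trans ?_
  calc _ ≤ B ^ p.1 * (‖wordCoeff hmn p.2 f‖ * D) :=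
        mul_le_mul (norm_prod_ofFn_le T hB _) (hρn _) (norm_nonneg _) (by positivity)
    _ = D * (B ^ p.1 * ‖wordCoeff hmn p.2 f‖) := by ring
    _ ≤ D * (((m + 1 : ℝ)⁻¹) ^ p.1 * M) :=
      mul_le_mul_of_nonneg_left (hcoeff hmn f hM p.2) hD0
    _ = _ := by ring

theorem wordCoeff_add {k : ℕ} (w : Fin k → Fin m) (f g : hyperholomorphic K hmn) :
    wordCoeff hmn w (f + g) = wordCoeff hmn w f + wordCoeff hmn w g := by
  simp [wordCoeff]

theorem wordCoeff_smul {k : ℕ} (w : Fin k → Fin m) (r : K) (f : hyperholomorphic K hmn) :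
    wordCoeff hmn w (r • f) = r • wordCoeff hmn w f := by
  simp [wordCoeff, smul_comm r]

/-- The operator series as a semilinear map. -/
noncomputable def fueterCalculusLinear [CompleteSpace H]
    (hρ : ∀ r : K, ρ (algebraMap K (Cl K n) r) = algebraMap K 𝕜 r • (1 : H₀ →L[𝕜] H₀)) :
    hyperholomorphic K hmn →ₛₗ[algebraMap K 𝕜] (H ⊗[𝕜] H₀ →L[𝕜] H ⊗[𝕜] H₀) where
  toFun f := ∑' p, opTerm hmn T ρ f p
  map_add' f g := by
    rw [← (summable_opTerm hmn T hρ f).tsum_add (summable_opTerm hmn T hρ g)]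
    simp only [opTerm, wordCoeff_add, map_add, TensorProduct.mapL_add_right]
  map_smul' r f := by
    rw [← (summable_opTerm hmn T hρ f).tsum_const_smul]
    simp only [opTerm, wordCoeff_smul, rep_smul hρ, TensorProduct.mapL_smul_right]

/-- The functional calculus: the regular variables are replaced by the operators in the
noncommutative Taylor expansion. -/
noncomputable def fueterCalculus [CompleteSpace H]
    (hρ : ∀ r : K, ρ (algebraMap K (Cl K n) r) = algebraMap K 𝕜 r • (1 : H₀ →L[𝕜] H₀)) :
    hyperholomorphic K hmn →SL[algebraMap K 𝕜] (H ⊗[𝕜] H₀ →L[𝕜] H ⊗[𝕜] H₀) where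
  toLinearMap := fueterCalculusLinear hmn T hρ
  cont := by
    obtain ⟨R, C, hC⟩ := exists_norm_tsum_opTerm_le hmn T hρ
    have : CompactSpace (closedBall (0 : RSpace m) R) :=
      isCompact_iff_compactSpace.1 (isCompact_closedBall 0 R)
    refine continuous_of_continuousAt_zero (fueterCalculusLinear hmn T hρ) ?_
    rw [ContinuousAt, map_zero, tendsto_zero_iff_norm_tendsto_zero]
    have hcont : Continuous fun f : hyperholomorphic K hmn =>
        C * ‖f.1.restrict (closedBall (0 : RSpace m) R)‖ :=
      continuous_const.mul
        ((ContinuousMap.continuous_restrict _).comp continuous_subtype_val).norm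
    have h0 := hcont.tendsto 0
    have hz : C * ‖(0 : hyperholomorphic K hmn).1.restrict (closedBall (0 : RSpace m) R)‖ = 0 := by
      rw [show (0 : hyperholomorphic K hmn).1.restrict (closedBall (0 : RSpace m) R) = 0 from rfl,
        norm_zero, mul_zero]
    rw [hz] at h0
    exact squeeze_zero (fun _ => norm_nonneg _) (fun f => hC f fun z hz =>
      (f.1.restrict (closedBall (0 : RSpace m) R)).norm_coe_le_norm ⟨z, hz⟩) h0

theorem hasSum_fueterCalculus [CompleteSpace H]
    (hρ : ∀ r : K, ρ (algebraMap K (Cl K n) r) = algebraMap K 𝕜 r • (1 : H₀ →L[𝕜] H₀))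
    (f : hyperholomorphic K hmn) :
    HasSum (fun α => TensorProduct.mapL (symPow 𝕜 T α) (ρ (fueterCoeff hmn f α)))
      (fueterCalculus hmn T hρ f) := by
  change HasSum _ (∑' p, opTerm hmn T ρ f p)
  convert (summable_opTerm hmn T hρ f).hasSum.sum_wordsOfContent using 2 with α
  simp only [opTerm, wordCoeff_eq_of_wordsOfContent, ← mapLRight_apply, ← map_sum]
  rw [sum_wordsOfContent_prod 𝕜 T, fueterCoeff, rep_smul hρ, map_natCast, mapLRight_apply,
    mapLRight_apply, TensorProduct.mapL_smul_left, TensorProduct.mapL_smul_right]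

/-- The functional calculus may be computed from any expansion in the symmetric polynomials. -/
theorem hasSum_fueterCalculus_of_hasSum [CompleteSpace H]
    (hρ : ∀ r : K, ρ (algebraMap K (Cl K n) r) = algebraMap K 𝕜 r • (1 : H₀ →L[𝕜] H₀))
    (f : hyperholomorphic K hmn) {c : (Fin m → ℕ) → Cl K n}
    (hc : ∀ x, HasSum (fun α => fueterPoly K hmn α x * c α) (f.1 x)) :
    HasSum (fun α => TensorProduct.mapL (symPow 𝕜 T α) (ρ (c α))) (fueterCalculus hmn T hρ f) := by
  rw [eq_of_hasSum_fueterPoly hmn (hasSum_fueterPoly hmn f) hc]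
  exact hasSum_fueterCalculus hmn T hρ f

theorem fueterCalculus_symProd [CompleteSpace H]
    (hρ : ∀ r : K, ρ (algebraMap K (Cl K n) r) = algebraMap K 𝕜 r • (1 : H₀ →L[𝕜] H₀))
    {k : ℕ} (w : Fin k → Fin m) (f : hyperholomorphic K hmn)
    (hf : ∀ x, f.1 x = symProd K fun i => regVar K hmn (w i) x) :
    fueterCalculus hmn T hρ f
      = symProd 𝕜 fun i => (TensorProduct.mapL (T (w i)) 1 : H ⊗[𝕜] H₀ →L[𝕜] H ⊗[𝕜] H₀) := by
  have h1 := hasSum_fueterCalculus_of_hasSum hmn T hρ f (c := Pi.single (wordContent w) 1)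
    fun x => by
      rw [hf, symProd_eq_symPow K (fun j => regVar K hmn j x) w]
      convert hasSum_single (wordContent w) fun α hα => ?_ using 1
      · simp [fueterPoly]
      · simp [hα]
  have h2 : HasSum (fun α => TensorProduct.mapL (symPow 𝕜 T α)
      (ρ ((Pi.single (wordContent w) 1 : (Fin m → ℕ) → Cl K n) α)))
      (TensorProduct.mapL (symPow 𝕜 T (wordContent w)) (1 : H₀ →L[𝕜] H₀)) := by
    convert hasSum_single (wordContent w) fun α hα => ?_ using 1
    · simp
    · simp [hα]
  rw [h1.unique h2, ← symProd_eq_symPow]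
  let θ : (H →L[𝕜] H) →+* (H ⊗[𝕜] H₀ →L[𝕜] H ⊗[𝕜] H₀) :=
    { toFun := fun S => TensorProduct.mapL S 1
      map_one' := TensorProduct.mapL_id_id
      map_mul' := fun S S' => by rw [← TensorProduct.mapL_mul, one_mul]
      map_zero' := TensorProduct.mapL_zero_left _
      map_add' := fun S S' => TensorProduct.mapL_add_left S S' _ }
  exact map_symProd 𝕜 (F' := 𝕜) θ (fun r => TensorProduct.mapL_smul_left _ _ _) fun i => T (w i)

/-- Right multiplication by a Clifford coefficient preserves hyperholomorphy. -/
theorem exists_hyperholomorphic_eq_mul_right (f : hyperholomorphic K hmn) (c : Cl K n) :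
    ∃ g : hyperholomorphic K hmn, ∀ x, g.1 x = f.1 x * c := by
  set L : Cl K n →L[ℝ] Cl K n := (Cl.mulL K n).flip c with hL
  refine ⟨⟨⟨fun x => f.1 x * c, f.1.continuous.mul continuous_const⟩,
    L.contDiff.comp f.2.1, fun x => ?_⟩, fun x => rfl⟩
  have h1 : fderiv ℝ (fun x => f.1 x * c) x = L.comp (fderiv ℝ f.1 x) :=
    (L.hasFDerivAt.comp x (hyperholomorphic_differentiable hmn f x).hasFDerivAt).fderiv
  have h2 := f.2.2 x
  rw [dirac_eq_sum] at h2 ⊢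
  have h3 (v : RSpace m) : fderiv ℝ (fun x => f.1 x * c) x v = fderiv ℝ f.1 x v * c := by
    rw [h1]
    rfl
  simp only [ContinuousMap.coe_mk, h3, ← mul_assoc, ← Finset.sum_mul, h2, zero_mul]

theorem fueterCalculus_mul_right [CompleteSpace H]
    (hρ : ∀ r : K, ρ (algebraMap K (Cl K n) r) = algebraMap K 𝕜 r • (1 : H₀ →L[𝕜] H₀))
    (f g : hyperholomorphic K hmn) (c : Cl K n) (hg : ∀ x, g.1 x = f.1 x * c) :
    fueterCalculus hmn T hρ g = fueterCalculus hmn T hρ f * TensorProduct.mapL 1 (ρ c) := by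
  have h1 := hasSum_fueterCalculus_of_hasSum hmn T hρ g (c := fun α => fueterCoeff hmn f α * c)
    fun x => by
      simp only [hg, ← mul_assoc]
      exact (hasSum_fueterPoly hmn f x).mapL ((Cl.mulL K n).flip c)
  have h2 := (hasSum_fueterCalculus hmn T hρ f).mul_right (TensorProduct.mapL 1 (ρ c))
  refine h1.unique (h2.congr_fun fun α => ?_)
  rw [map_mul, ← TensorProduct.mapL_mul, mul_one]

theorem symProd_fin_one (F : Type*) [Field F] {R : Type*} [Ring R] [Algebra F R] (a : Fin 1 → R) :
    symProd F a = a 0 := by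
  simp [symProd]

end Calculus

theorem mainTheorem2 {K 𝕜 : Type*} [RCLike K] [RCLike 𝕜] [NormedAlgebra K 𝕜]
    {m n : ℕ} (hmn : m ≤ n)
    {H : Type*} [NormedAddCommGroup H] [InnerProductSpace 𝕜 H] [CompleteSpace H]
    (T : Fin m → H →L[𝕜] H) (hT : ∀ j, IsSelfAdjoint (T j))
    {H₀ : Type*} [NormedAddCommGroup H₀] [InnerProductSpace 𝕜 H₀] [FiniteDimensional 𝕜 H₀]
    (ρ : Cl K n →+* (H₀ →L[𝕜] H₀))
    (hρ : ∀ r : K, ρ (algebraMap K (Cl K n) r) = algebraMap K 𝕜 r • (1 : H₀ →L[𝕜] H₀)) :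
    ∃ Φ : hyperholomorphic K hmn →SL[algebraMap K 𝕜] (H ⊗[𝕜] H₀ →L[𝕜] H ⊗[𝕜] H₀),
      IsHyperholomorphicCalculus hmn T ρ Φ ∧
      ∀ f : hyperholomorphic K hmn, ∃ c : (Fin m → ℕ) → Cl K n,
        HasSum (fun α => fueterTerm K hmn α (c α)) f.1 ∧
        (∀ c' : (Fin m → ℕ) → Cl K n,
          (∀ x, HasSum (fun α => fueterPoly K hmn α x * c' α) (f.1 x)) → c' = c) ∧
        HasSum (fun α => TensorProduct.mapL (symPow 𝕜 T α) (ρ (c α))) (Φ f) := by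
  refine ⟨fueterCalculus hmn T hρ, ⟨fun j => ?_, fun k w => ?_, fun f c => ?_⟩, fun f => ?_⟩
  · obtain ⟨f, hf⟩ := exists_hyperholomorphic_eq_symProd_regVar (K := K) hmn fun _ : Fin 1 => j
    refine ⟨f, fun x => by rw [hf, symProd_fin_one], ?_⟩
    rw [fueterCalculus_symProd hmn T hρ _ f hf, symProd_fin_one]
  · obtain ⟨f, hf⟩ := exists_hyperholomorphic_eq_symProd_regVar (K := K) hmn w
    exact ⟨f, hf, fueterCalculus_symProd hmn T hρ w f hf⟩
  · obtain ⟨g, hg⟩ := exists_hyperholomorphic_eq_mul_right hmn f c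
    exact ⟨g, hg, fueterCalculus_mul_right hmn T hρ f g c hg⟩
  · exact ⟨fueterCoeff hmn f, hasSum_fueterTerm hmn f,
      fun c' hc' => eq_of_hasSum_fueterPoly hmn (hasSum_fueterPoly hmn f) hc',
      hasSum_fueterCalculus hmn T hρ f⟩
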